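/- Let $m,n\ge 0$ be integers with $m+n\ge 1$, let $a\neq b$ and $a_m<\dots<a_1<0<b_1<\dots<b_n$ be real numbers, and put $l_0=y-ax$, $g_0=y-bx$, $l_i=x-a_i$ $(1\le i\le m)$, $g_j=x-b_j$ $(1\le j\le n)$ and $$f(x,y)=\prod_{i=0}^m l_i(x,y)\prod_{j=0}^n g_j(x,y).$$ Assume that these $m+n+2$ linear factors are in good position, that is, for each of them, its zero line contains no critical point of the product of all the others. Then: (1) The Hessian curve $\{f_{xx}f_{yy}-f_{xy}^2=0\}\subset\mathbb R^2$ is a compact smooth plane curve with exactly $m+n$ connected components, and all of them are outer ovals: each lies in the unbounded component of the complement of each of the other components. (2) The graph of $f$ has exactly $3(m+n)$ special parabolic points. (3) The inflexion curve of the graph of $f$, projected to the $xy$-plane, is the set $\{f(x,y)=0\}$. The latter is also exactly the set of all points $p\in\mathbb R^2$ such that some tangent line of the graph at $(p,f(p))$ has order of contact greater than $3$ with the graph. Here a tangent line is asymptotic if its order of contact with the graph at the point of tangency is at least $3$. A point is elliptic if all tangent lines at it have order of contact exactly $2$, hyperbolic if it has exactly two asymptotic lines, and parabolic otherwise. A special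 parabolic point is a parabolic point near which the set of parabolic points is a smooth curve, at which the $4$-jet of $f$ without its constant and linear terms is not, as a $4$-jet and up to sign, the square of a jet, and which has exactly one asymptotic line, the order of contact of that line being at least $4$. An inflexion point is a hyperbolic point with at least one asymptotic line of order of contact greater than $3$, and the inflexion curve is the closure of the set of inflexion points. -/

import Mathlib

open Set Filter Topology Asymptotics
open scoped ContDiff

namespace HessianTopology

/-- The partial derivative of `f` with respect to the first variable. -/
noncomputable def dx (f : ℝ × ℝ → ℝ) (p : ℝ × ℝ) : ℝ := deriv (fun s : ℝ => f (s, p.2)) p.1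

/-- The partial derivative of `f` with respect to the second variable. -/
noncomputable def dy (f : ℝ × ℝ → ℝ) (p : ℝ × ℝ) : ℝ := deriv (fun s : ℝ => f (p.1, s)) p.2

/-- The Hessian `f_xx f_yy - f_xy ^ 2`. -/
noncomputable def hess (f : ℝ × ℝ → ℝ) (p : ℝ × ℝ) : ℝ :=
  dx (dx f) p * dy (dy f) p - (dy (dx f) p) ^ 2

/-- The Hessian curve of `f`: the zero set of the Hessian. -/
def hessianCurve (f : ℝ × ℝ → ℝ) : Set (ℝ × ℝ) := {p | hess f p = 0}

/-! Plane curves and outer ovals -/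

/-- The plane set `C` is a smooth curve near `p`: near `p` it is the zero set of a smooth
function whose differential at `p` does not vanish. -/
def IsSmoothCurveAt (C : Set (ℝ × ℝ)) (p : ℝ × ℝ) : Prop :=
  p ∈ C ∧ ∃ g : ℝ × ℝ → ℝ, ContDiff ℝ ∞ g ∧ fderiv ℝ g p ≠ 0 ∧ ∀ᶠ q in 𝓝 p, (q ∈ C ↔ g q = 0)

/-- The connected components of a plane set, as subsets of the plane. -/
def components (C : Set (ℝ × ℝ)) : Set (Set (ℝ × ℝ)) :=
  {K | ∃ p ∈ C, K = connectedComponentIn C p}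

/-- The outside of a compact plane set `K`: the unbounded component of its complement. -/
def outside (K : Set (ℝ × ℝ)) : Set (ℝ × ℝ) :=
  {q | q ∈ Kᶜ ∧ ¬ Bornology.IsBounded (connectedComponentIn Kᶜ q)}

/-- `K` is an outer oval of the curve `C`: a connected component of `C` that lies in the outside
of every (other) connected component. -/
def IsOuterOval (C K : Set (ℝ × ℝ)) : Prop :=
  K ∈ components C ∧ ∀ K' ∈ components C, K' ≠ K → K ⊆ outside K'

/-- `C` is a compact smooth plane curve that consists of exactly `k` outer ovals. -/
def ConsistsOfOuterOvals (C : Set (ℝ × ℝ)) (k : ℕ) : Prop :=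
  IsCompact C ∧ (∀ p ∈ C, IsSmoothCurveAt C p) ∧ (components C).encard = k ∧
    ∀ K ∈ components C, IsOuterOval C K

/-! Points of the graph `z = f (x, y)`. The point `(p, f p)` of the graph is represented by `p`,
and the tangent line at it with direction `(v, df_p v)` by `v ≠ 0`, or by the line spanned by `v`
when tangent lines have to be counted. -/

/-- The order of contact of the graph of `f` at `(p, f p)` with the tangent line that projects to
the direction `v`: the order of vanishing at `0` of the restriction to that line of the
equation of the graph. It is `⊤` if the line is contained in the graph. -/
noncomputable def contactOrder (f : ℝ × ℝ → ℝ) (p v : ℝ × ℝ) : ℕ∞ :=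
  analyticOrderAt (fun t : ℝ => f (p + t • v) - (f p + t * fderiv ℝ f p v)) 0

/-- The set of asymptotic lines at `p`: the tangent lines with contact of order at least 3. -/
def asymptoticLines (f : ℝ × ℝ → ℝ) (p : ℝ × ℝ) : Set (Submodule ℝ (ℝ × ℝ)) :=
  {L | ∃ v : ℝ × ℝ, v ≠ 0 ∧ L = Submodule.span ℝ {v} ∧ 3 ≤ contactOrder f p v}

/-- Elliptic point: all tangent lines have contact of order 2. -/
def IsElliptic (f : ℝ × ℝ → ℝ) (p : ℝ × ℝ) : Prop :=
  ∀ v : ℝ × ℝ, v ≠ 0 → contactOrder f p v = 2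

/-- Hyperbolic point: there are exactly two asymptotic lines. -/
def IsHyperbolic (f : ℝ × ℝ → ℝ) (p : ℝ × ℝ) : Prop :=
  (asymptoticLines f p).encard = 2

/-- The parabolic curve: the points that are neither elliptic nor hyperbolic. -/
def parabolicCurve (f : ℝ × ℝ → ℝ) : Set (ℝ × ℝ) :=
  {p | ¬ IsElliptic f p ∧ ¬ IsHyperbolic f p}

/-- The 4-jet of `f` at `p`, without its constant and linear terms, is a perfect square: up to
terms of order at least 5 it is a real multiple of the square of a smooth function (equivalently,
plus or minus the square of a jet; both signs are needed for the notion not to change when `f`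
is replaced by `-f`). -/
def IsSquareFourJet (f : ℝ × ℝ → ℝ) (p : ℝ × ℝ) : Prop :=
  ∃ (c : ℝ) (q : ℝ × ℝ → ℝ), ContDiff ℝ ∞ q ∧
    (fun h : ℝ × ℝ => f (p + h) - (f p + fderiv ℝ f p h) - c * q h ^ 2)
      =O[𝓝 0] fun h : ℝ × ℝ => ‖h‖ ^ 5

/-- Special parabolic point (godron, Gaussian cusp). -/
def IsSpecialParabolic (f : ℝ × ℝ → ℝ) (p : ℝ × ℝ) : Prop :=
  p ∈ parabolicCurve f ∧ IsSmoothCurveAt (parabolicCurve f) p ∧ ¬ IsSquareFourJet f p ∧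
    (asymptoticLines f p).encard = 1 ∧
    ∀ v : ℝ × ℝ, v ≠ 0 → 3 ≤ contactOrder f p v → 4 ≤ contactOrder f p v

/-- Inflexion point: a hyperbolic point with at least one asymptotic line whose order of contact
is greater than 3. -/
def IsInflexion (f : ℝ × ℝ → ℝ) (p : ℝ × ℝ) : Prop :=
  IsHyperbolic f p ∧ ∃ v : ℝ × ℝ, v ≠ 0 ∧ 3 < contactOrder f p v

/-- The inflexion curve: the closure of the set of inflexion points. -/
def inflexionCurve (f : ℝ × ℝ → ℝ) : Set (ℝ × ℝ) := closure {p | IsInflexion f p}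

/-- The points, hyperbolic or not, with an asymptotic line of order of contact greater than 3. -/
def overContactSet (f : ℝ × ℝ → ℝ) : Set (ℝ × ℝ) :=
  {p | ∃ v : ℝ × ℝ, v ≠ 0 ∧ 3 < contactOrder f p v}

/-! Products of polynomials of degree one -/

/-- A finite family of polynomials of degree one is in good position: the line `l i = 0` contains
no critical point of the product of the others. -/
def GoodPosition {ι : Type*} [Fintype ι] [DecidableEq ι] (l : ι → ℝ × ℝ → ℝ) : Prop :=
  ∀ (i : ι) (p : ℝ × ℝ), l i p = 0 →
    fderiv ℝ (fun q : ℝ × ℝ => ∏ j ∈ Finset.univ.erase i, l j q) p ≠ 0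

/-- The family `y - a x, x - c 0, …, x - c (k - 1)`. -/
def linearFactors {k : ℕ} (a : ℝ) (c : Fin k → ℝ) : Fin (k + 1) → ℝ × ℝ → ℝ :=
  Fin.cons (fun p => p.2 - a * p.1) (fun i p => p.1 - c i)

end HessianTopology

open HessianTopology

/-! With `s = (a + b) / 2`, `c = (a - b) / 2` and `u = y - s x`, the function is `f = P(x) (u² - c²
x²)`, where `P` has the `N = m + n` simple nonzero roots `a_i`, `b_j`. Its Hessian is `-2 (D u² + c²
Q)` with `D = 2 P'² - P P''` and `Q = P (x² P)''`. Everything rests on real-rootedness.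

Ovals. Laguerre's inequality gives `D > 0`, so the Hessian curve is `u² = -c² Q / D`. By Rolle `(x²
P)''` is real-rooted; good position makes the `2N` roots of `Q` simple. Since `Q` has positive
leading coefficient, it is nonpositive exactly on `N` disjoint intervals, each carrying one oval
(`exists_intervals`, `components_of_intervals`).

Contact. The restriction `g` of `f` to any line is real-rooted. Contact of order at least 4 means
`g'' = g''' = 0` at the point, and a multiple root of the derivative of a real-rooted polynomial is
a root of the polynomial; applied twice, this gives `f = 0` there
(`lineProduct_eq_zero_of_contact`). Conversely, every point of `f = 0` lies on a line contained in
the graph.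

Special points. On each zero line the Hessian is minus a square, vanishing at `u = 0` on a vertical
line and at the `N` critical points of `x P` on a slanted one. This gives `N + 2N` parabolic points
on `f = 0`; all other points of `f = 0` are inflexions, hence dense in it. That the 4-jet is no
square there is checked along parabolas tangent to the zero line (`not_isSquareFourJet`). -/

namespace HessianTopology

/-! ### Real-rooted polynomials -/

open Polynomial in
-- Rolle: differentiation loses at most one root, counted with multiplicity.
theorem splits_derivative {p : ℝ[X]} (hp : p.Splits) : (derivative p).Splits := by
  rcases Nat.eq_zero_or_pos p.natDegree with h | h
  · rw [eq_C_of_natDegree_eq_zero h]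
    simp
  · rw [splits_iff_card_roots] at hp ⊢
    have h1 := card_roots_le_derivative p
    have h2 := natDegree_derivative_le p
    have h3 := card_roots' (derivative p)
    omega

open Polynomial in
/-- The Laguerre inequality for real-rooted polynomials. -/
theorem sq_derivative_sub_pos {p : ℝ[X]} (hp : p.Splits) (hd : p.natDegree ≠ 0) {x : ℝ}
    (hx : p.eval x ≠ 0) :
    0 < (derivative p).eval x ^ 2 - p.eval x * (derivative (derivative p)).eval x := by
  have key : ∀ (m : Multiset ℝ) (q : ℝ[X]), q = (m.map (X - C ·)).prod →
      0 ≤ (derivative q).eval x ^ 2 - q.eval x * (derivative (derivative q)).eval x ∧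
      (m ≠ 0 → q.eval x ≠ 0 →
        0 < (derivative q).eval x ^ 2 - q.eval x * (derivative (derivative q)).eval x) := by
    intro m
    induction m using Multiset.induction_on with
    | empty => rintro q rfl; simp
    | cons r m ih =>
      rintro q rfl
      obtain ⟨h1, -⟩ := ih _ rfl
      set q := (m.map (X - C ·)).prod
      have e : ((r ::ₘ m).map (X - C ·)).prod = (X - C r) * q := by simp [q]
      rw [e]
      -- A new factor `x - r` multiplies the expression by `(x - r)²` and adds `q²`, which is
      -- positive off the roots.
      have e2 : (derivative ((X - C r) * q)).eval x ^ 2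
          - ((X - C r) * q).eval x * (derivative (derivative ((X - C r) * q))).eval x
          = q.eval x ^ 2 + (x - r) ^ 2 * ((derivative q).eval x ^ 2
            - q.eval x * (derivative (derivative q)).eval x) := by
        simp [derivative_mul]
        ring
      rw [e2]
      refine ⟨by positivity, fun _ h => ?_⟩
      have : q.eval x ≠ 0 := by
        intro h0
        apply h
        simp [h0]
      positivity
  obtain ⟨-, h⟩ := key p.roots _ rfl
  have e := hp.eq_prod_roots
  set q := (p.roots.map (X - C ·)).prod
  have hq : q.eval x ≠ 0 := by
    intro h0
    apply hx
    rw [e]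
    simp [h0]
  have h := h (hp.roots_ne_zero hd) hq
  have hl : p.leadingCoeff ≠ 0 := by
    rw [Ne, leadingCoeff_eq_zero]
    rintro rfl
    simp at hd
  have e2 : (derivative p).eval x ^ 2 - p.eval x * (derivative (derivative p)).eval x =
      p.leadingCoeff ^ 2 * ((derivative q).eval x ^ 2
        - q.eval x * (derivative (derivative q)).eval x) := by
    rw [congrArg (fun p => eval x (derivative p)) e,
      congrArg (fun p => eval x p) e, congrArg (fun p => eval x (derivative (derivative p))) e]
    simp
    ring
  rw [e2]
  positivity

open Polynomial in
/-- A multiple root of the derivative of a real-rooted polynomial is a root of the polynomial. -/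
theorem eval_eq_zero_of_derivative {p : ℝ[X]} (hp : p.Splits) (hd : p.natDegree ≠ 0) {x : ℝ}
    (h1 : (derivative p).eval x = 0) (h2 : (derivative (derivative p)).eval x = 0) :
    p.eval x = 0 := by
  by_contra h
  have := sq_derivative_sub_pos hp hd h
  simp [h1, h2] at this

open Polynomial in
theorem exists_finset_roots {p : ℝ[X]} (hp : p.Splits) (hp0 : p ≠ 0)
    (hs : ∀ x, p.eval x = 0 → (derivative p).eval x ≠ 0) :
    ∃ T : Finset ℝ, T.card = p.natDegree ∧ (∀ x, x ∈ T ↔ p.eval x = 0) ∧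
      ∀ x, p.eval x = p.leadingCoeff * ∏ t ∈ T, (x - t) := by
  have hn : p.roots.Nodup := by
    rw [Multiset.nodup_iff_count_le_one]
    intro a
    rw [count_roots]
    by_contra h
    rw [not_le, one_lt_rootMultiplicity_iff_isRoot hp0] at h
    exact hs a h.1 h.2
  refine ⟨⟨p.roots, hn⟩, ?_, ?_, ?_⟩
  · rw [hp.natDegree_eq_card_roots]; rfl
  · intro x
    simp [hp0]
  · intro x
    rw [hp.eval_eq_prod_roots]
    rfl

/-- Group the points of a finite set into consecutive pairs. -/
theorem exists_pairing {N : ℕ} (Z : Finset ℝ) (hZ : Z.card = 2 * N) :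
    ∃ l r : Fin N → ℝ, (∀ k, l k < r k) ∧ (∀ k k', k < k' → r k < l k') ∧
      (∀ k, l k ∈ Z ∧ r k ∈ Z) ∧
      ∀ x : ℝ, ∏ z ∈ Z, (x - z) = ∏ k, ((x - l k) * (x - r k)) := by
  set e := Z.orderEmbOfFin hZ
  refine ⟨fun k => e ⟨2 * k, by omega⟩, fun k => e ⟨2 * k + 1, by omega⟩, ?_, ?_, ?_, ?_⟩
  · intro k
    apply e.strictMono
    simp
  · intro k k' h
    apply e.strictMono
    rw [Fin.lt_def] at h ⊢
    simp only
    omega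
  · exact fun k => ⟨Z.orderEmbOfFin_mem hZ _, Z.orderEmbOfFin_mem hZ _⟩
  · intro x
    have h1 : ∏ z ∈ Z, (x - z) = ∏ i : Fin (2 * N), (x - e i) := by
      conv_lhs => rw [← Z.image_orderEmbOfFin_univ hZ]
      rw [Finset.prod_image (fun a _ b _ h => e.injective h)]
    rw [h1]
    -- Extension to `ℕ`, so that the product can be regrouped by induction; the value `1` is never
    -- reached.
    set g : ℕ → ℝ := fun i => if h : i < 2 * N then x - e ⟨i, h⟩ else 1 with hg
    have h2 : ∀ M, ∏ i ∈ Finset.range (2 * M), g i =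
        ∏ k ∈ Finset.range M, (g (2 * k) * g (2 * k + 1)) := by
      intro M
      induction M with
      | zero => simp
      | succ M ih =>
        rw [Finset.prod_range_succ, ← ih, mul_add, mul_one, Finset.prod_range_succ,
          Finset.prod_range_succ, mul_assoc]
    have h3 := h2 N
    rw [← Fin.prod_univ_eq_prod_range, ← Fin.prod_univ_eq_prod_range] at h3
    convert h3 using 2 with i _ k
    · simp [hg]
    · have := k.2
      have a1 : 2 * (k : ℕ) < 2 * N := by omega
      have a2 : 2 * (k : ℕ) + 1 < 2 * N := by omega
      simp [hg, a1, a2]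

end HessianTopology

/-! ### Curves `(y - s x)² = V(x)` over separated intervals -/

namespace HessianTopology

/-- A point lies in at most one of the intervals, so at most one factor is nonpositive. -/
theorem prod_pairs_nonpos_iff {N : ℕ} {l r : Fin N → ℝ} (hlr : ∀ k, l k < r k)
    (hsep : ∀ k k', k < k' → r k < l k') (x : ℝ) :
    ∏ k, ((x - l k) * (x - r k)) ≤ 0 ↔ ∃ k, x ∈ Icc (l k) (r k) := by
  have hpos : ∀ k, x ∉ Icc (l k) (r k) → 0 < (x - l k) * (x - r k) := by
    intro k hk
    rw [mem_Icc, not_and_or, not_le, not_le] at hk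
    have := hlr k
    rcases hk with hk | hk
    · exact mul_pos_of_neg_of_neg (by linarith) (by linarith)
    · exact mul_pos (by linarith) (by linarith)
  constructor
  · intro h
    by_contra! hx
    exact absurd (Finset.prod_pos fun k _ => hpos k (hx k)) (not_lt.mpr h)
  · rintro ⟨k, hk⟩
    rw [← Finset.mul_prod_erase _ _ (Finset.mem_univ k)]
    refine mul_nonpos_of_nonpos_of_nonneg
      (mul_nonpos_of_nonneg_of_nonpos (by linarith [hk.1]) (by linarith [hk.2]))
      (Finset.prod_nonneg fun j hj => (hpos j fun hjx => ?_).le)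
    rcases lt_or_gt_of_ne (Finset.ne_of_mem_erase hj) with h | h
    · linarith [hsep _ _ h, hjx.2, hk.1]
    · linarith [hsep _ _ h, hk.2, hjx.1]

/-- The part over `[l, r]` of the curve `(y - s x) ^ 2 = V x`. -/
def oval (s : ℝ) (V : ℝ → ℝ) (l r : ℝ) : Set (ℝ × ℝ) :=
  {p | p.1 ∈ Icc l r ∧ (p.2 - s * p.1) ^ 2 = V p.1}

section oval
variable {s : ℝ} {V : ℝ → ℝ} {l r : ℝ}

theorem oval_eq_union (hV : ∀ x ∈ Icc l r, 0 ≤ V x) :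
    oval s V l r = (fun x => (x, s * x + √(V x))) '' Icc l r ∪
      (fun x => (x, s * x - √(V x))) '' Icc l r := by
  ext ⟨x, y⟩
  simp only [oval, mem_ofPred_eq, mem_union, mem_image, Prod.mk.injEq]
  constructor
  · rintro ⟨hx, h⟩
    rcases sq_eq_sq_iff_eq_or_eq_neg.mp (h.trans (Real.sq_sqrt (hV x hx)).symm) with h | h
    · exact Or.inl ⟨x, hx, rfl, by linarith⟩
    · exact Or.inr ⟨x, hx, rfl, by linarith⟩
  · rintro (⟨x, hx, rfl, rfl⟩ | ⟨x, hx, rfl, rfl⟩) <;> refine ⟨hx, ?_⟩ <;> ring_nf <;>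
      exact Real.sq_sqrt (hV x hx)

theorem isCompact_oval (hc : Continuous V) (hV : ∀ x ∈ Icc l r, 0 ≤ V x) :
    IsCompact (oval s V l r) := by
  rw [oval_eq_union hV]
  exact (isCompact_Icc.image (by fun_prop)).union (isCompact_Icc.image (by fun_prop))

/-- The graphs of `s x ± √V` over the interval are connected and meet over `l`. -/
theorem isPreconnected_oval (hc : Continuous V) (hV : ∀ x ∈ Icc l r, 0 ≤ V x) (hlr : l ≤ r)
    (hl : V l = 0) : IsPreconnected (oval s V l r) := by
  rw [oval_eq_union hV]
  refine IsPreconnected.union (l, s * l) ⟨l, left_mem_Icc.mpr hlr, by simp [hl]⟩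
    ⟨l, left_mem_Icc.mpr hlr, by simp [hl]⟩ ?_ ?_
  · exact isPreconnected_Icc.image _ (by fun_prop)
  · exact isPreconnected_Icc.image _ (by fun_prop)

end oval

/-- The vertical line through a point of `K` is connected, unbounded and misses `K'`. -/
theorem subset_outside_of_fst {K K' : Set (ℝ × ℝ)} (h : ∀ p ∈ K, ∀ q ∈ K', p.1 ≠ q.1) :
    K ⊆ outside K' := by
  intro p hp
  have hsub : range (fun y : ℝ => (p.1, y)) ⊆ K'ᶜ := by
    rintro _ ⟨y, rfl⟩ hy
    exact h p hp _ hy rfl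
  have hp' : p ∈ range (fun y : ℝ => (p.1, y)) := ⟨p.2, rfl⟩
  refine ⟨hsub hp', fun hb => ?_⟩
  have hconn : IsPreconnected (range (fun y : ℝ => (p.1, y))) :=
    isPreconnected_range (by fun_prop)
  have hb2 := hb.subset (hconn.subset_connectedComponentIn hp' hsub)
  obtain ⟨M, hM⟩ := hb2.exists_norm_le
  have := hM (p.1, |M| + 1) ⟨_, rfl⟩
  have h2 := (norm_snd_le (p.1, |M| + 1)).trans this
  simp only [Real.norm_eq_abs] at h2
  have h3 := le_abs_self (|M| + 1)
  have h4 := le_abs_self M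
  linarith

/-- The ovals are finitely many connected compact sets with disjoint projections to the first axis,
hence they are the components, each outside the others. -/
theorem components_of_intervals {N : ℕ} {s : ℝ} {V : ℝ → ℝ} (hc : Continuous V)
    {l r : Fin N → ℝ} (hlr : ∀ k, l k < r k) (hsep : ∀ k k', k < k' → r k < l k')
    (hl : ∀ k, V (l k) = 0) (hV : ∀ x, 0 ≤ V x ↔ ∃ k, x ∈ Icc (l k) (r k))
    {C : Set (ℝ × ℝ)} (hC : C = {p | (p.2 - s * p.1) ^ 2 = V p.1}) :
    IsCompact C ∧ (components C).encard = N ∧ ∀ K ∈ components C, IsOuterOval C K := by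
  set O : Fin N → Set (ℝ × ℝ) := fun k => oval s V (l k) (r k) with hO
  have hCO : C = ⋃ k, O k := by
    ext p
    simp only [hC, hO, oval, mem_ofPred_eq, mem_iUnion]
    constructor
    · intro h
      obtain ⟨k, hk⟩ := (hV p.1).mp (h ▸ sq_nonneg _)
      exact ⟨k, hk, h⟩
    · rintro ⟨k, -, h⟩
      exact h
  have hnn : ∀ k, ∀ x ∈ Icc (l k) (r k), 0 ≤ V x := fun k x hx => (hV x).mpr ⟨k, hx⟩
  have hcomp : ∀ k, IsCompact (O k) := fun k => isCompact_oval hc (hnn k)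
  have hfst : ∀ j k, j ≠ k → ∀ p ∈ O j, ∀ q ∈ O k, p.1 ≠ q.1 := by
    rintro j k hjk p ⟨hp, -⟩ q ⟨hq, -⟩ h
    rcases lt_or_gt_of_ne hjk with h' | h'
    · linarith [hsep _ _ h', hp.2, hq.1]
    · linarith [hsep _ _ h', hp.1, hq.2]
  have hcc : ∀ k, ∀ p ∈ O k, connectedComponentIn C p = O k := by
    intro k p hp
    apply Subset.antisymm
    · have hpre : IsPreconnected (connectedComponentIn C p) := isPreconnected_connectedComponentIn
      have hpC : p ∈ C := hCO ▸ mem_iUnion.mpr ⟨k, hp⟩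
      have hsub : connectedComponentIn C p ⊆
          O k ∪ ⋃ j ∈ (Finset.univ.erase k : Finset (Fin N)), O j := by
        refine (connectedComponentIn_subset C p).trans ?_
        rw [hCO]
        refine iUnion_subset fun j => ?_
        by_cases hj : j = k
        · subst hj; exact subset_union_left
        · exact subset_union_of_subset_right
            (subset_biUnion_of_mem (u := O) (Finset.mem_coe.mpr (Finset.mem_erase.mpr
              ⟨hj, Finset.mem_univ j⟩))) _
      have hdisj : connectedComponentIn C p ∩
          (O k ∩ ⋃ j ∈ (Finset.univ.erase k : Finset (Fin N)), O j) = ∅ := by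
        rw [eq_empty_iff_forall_notMem]
        rintro q ⟨-, hq, hq2⟩
        obtain ⟨j, hj, hqj⟩ := mem_iUnion₂.mp hq2
        exact hfst j k (Finset.ne_of_mem_erase hj) q hqj q hq rfl
      rcases isPreconnected_iff_subset_of_disjoint_closed.mp hpre (O k)
        (⋃ j ∈ (Finset.univ.erase k : Finset (Fin N)), O j) (hcomp k).isClosed
        (isClosed_biUnion_finset fun j _ => (hcomp j).isClosed) hsub hdisj with h | h
      · exact h
      · exfalso
        obtain ⟨j, hj, hpj⟩ := mem_iUnion₂.mp (h (mem_connectedComponentIn hpC))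
        exact hfst j k (Finset.ne_of_mem_erase hj) p hpj p hp rfl
    · exact (isPreconnected_oval hc (hnn k) (hlr k).le (hl k)).subset_connectedComponentIn hp
        (hCO ▸ subset_iUnion O k)
  have hmem : ∀ k, (l k, s * l k) ∈ O k := fun k =>
    ⟨left_mem_Icc.mpr (hlr k).le, by simp [hl k]⟩
  have hcomps : components C = range O := by
    ext K
    constructor
    · rintro ⟨p, hp, rfl⟩
      obtain ⟨k, hk⟩ := mem_iUnion.mp (hCO ▸ hp)
      exact ⟨k, (hcc k p hk).symm⟩
    · rintro ⟨k, rfl⟩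
      exact ⟨_, hCO ▸ mem_iUnion.mpr ⟨k, hmem k⟩, (hcc k _ (hmem k)).symm⟩
  have hinj : Function.Injective O := by
    intro j k hjk
    by_contra hne
    exact hfst j k hne _ (hmem j) _ (hjk ▸ hmem j) rfl
  refine ⟨hCO ▸ isCompact_iUnion hcomp, ?_, fun K hK => ⟨hK, fun K' hK' hne => ?_⟩⟩
  · rw [hcomps, ← image_univ, hinj.encard_image]
    simp
  · rw [hcomps] at hK hK'
    obtain ⟨j, rfl⟩ := hK
    obtain ⟨k, rfl⟩ := hK'
    exact subset_outside_of_fst (hfst j k fun h => hne (by rw [h]))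

end HessianTopology

namespace HessianTopology

/-! Orders of contact and binary quadratic forms -/

open Polynomial in
theorem natCast_le_analyticOrderAt_eval (n : ℕ) (g : ℝ[X]) :
    (n : ℕ∞) ≤ analyticOrderAt (fun t => g.eval t) 0 ↔ ∀ d < n, g.coeff d = 0 := by
  have han : ∀ q : ℝ[X], AnalyticAt ℝ (fun t => q.eval t) 0 := fun q => by
    simpa using AnalyticAt.aeval_polynomial (analyticAt_id (𝕜 := ℝ) (z := (0 : ℝ))) q
  rw [natCast_le_analyticOrderAt (han g), ← X_pow_dvd_iff]
  constructor
  · intro h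
    by_cases hg : g = 0
    · simp [hg]
    obtain ⟨q, hq, hq0⟩ := exists_eq_pow_rootMultiplicity_mul_and_not_dvd g hg 0
    set k := g.rootMultiplicity 0
    rw [C_0, sub_zero] at hq hq0
    rw [X_dvd_iff, coeff_zero_eq_eval_zero] at hq0
    have hord : analyticOrderAt (fun t => g.eval t) 0 = (k : ℕ∞) :=
      (han g).analyticOrderAt_eq_natCast.mpr
        ⟨fun t => q.eval t, han q, hq0, Eventually.of_forall fun t => by
          rw [hq]; simp⟩
    have hle := (natCast_le_analyticOrderAt (han g)).mpr h
    rw [hord, Nat.cast_le] at hle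
    rw [hq]
    exact (pow_dvd_pow X hle).mul_right q
  · rintro ⟨q, rfl⟩
    exact ⟨fun t => q.eval t, han q, Eventually.of_forall fun t => by simp⟩

section contact
variable {f : ℝ × ℝ → ℝ} {p v : ℝ × ℝ} {g : Polynomial ℝ}

theorem hasDerivAt_line (hf : DifferentiableAt ℝ f p) :
    HasDerivAt (fun t : ℝ => f (p + t • v)) (fderiv ℝ f p v) 0 := by
  have h2 : HasDerivAt (fun t : ℝ => p + t • v) v 0 := by
    simpa using ((hasDerivAt_id (0 : ℝ)).smul_const v).const_add p
  have h3 : HasFDerivAt f (fderiv ℝ f p) (p + (0 : ℝ) • v) := by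
    simpa using hf.hasFDerivAt
  exact h3.comp_hasDerivAt 0 h2

open Polynomial in
theorem fderiv_apply_of_eval (hf : DifferentiableAt ℝ f p)
    (hg : ∀ t : ℝ, f (p + t • v) = g.eval t) : fderiv ℝ f p v = (derivative g).eval 0 := by
  have h1 := hasDerivAt_line (v := v) hf
  simp_rw [hg] at h1
  exact h1.unique (g.hasDerivAt 0)

open Polynomial in
-- Subtracting the tangent line removes exactly the coefficients of degree 0 and 1, hence the shift
-- by 2.
theorem natCast_add_two_le_contactOrder (hf : DifferentiableAt ℝ f p)
    (hg : ∀ t : ℝ, f (p + t • v) = g.eval t) (n : ℕ) :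
    ((n + 2 : ℕ) : ℕ∞) ≤ contactOrder f p v ↔ ∀ d < n, g.coeff (d + 2) = 0 := by
  have hd : fderiv ℝ f p v = g.coeff 1 := by
    rw [fderiv_apply_of_eval hf hg, ← coeff_zero_eq_eval_zero, coeff_derivative]
    simp
  have h0 : f p = g.coeff 0 := by
    have := hg 0
    rwa [zero_smul, add_zero, ← coeff_zero_eq_eval_zero] at this
  have he : (fun t : ℝ => f (p + t • v) - (f p + t * fderiv ℝ f p v)) =
      fun t => (g - (C (g.coeff 0) + C (g.coeff 1) * X)).eval t := by
    funext t
    rw [hg, h0, hd]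
    simp
    ring
  rw [contactOrder, he, natCast_le_analyticOrderAt_eval]
  constructor
  · intro h d hd
    have := h (d + 2) (by omega)
    simpa [coeff_X, coeff_C] using this
  · intro h d hd
    match d with
    | 0 => simp
    | 1 => simp [coeff_C]
    | d + 2 => simpa [coeff_X, coeff_C] using h d (by omega)

open Polynomial in
theorem three_le_contactOrder (hf : DifferentiableAt ℝ f p)
    (hg : ∀ t : ℝ, f (p + t • v) = g.eval t) :
    3 ≤ contactOrder f p v ↔ (derivative (derivative g)).eval 0 = 0 := by
  have := natCast_add_two_le_contactOrder hf hg 1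
  rw [← coeff_zero_eq_eval_zero, coeff_derivative, coeff_derivative]
  norm_num at this ⊢
  exact this

open Polynomial in
theorem four_le_contactOrder (hf : DifferentiableAt ℝ f p)
    (hg : ∀ t : ℝ, f (p + t • v) = g.eval t) :
    4 ≤ contactOrder f p v ↔ (derivative (derivative g)).eval 0 = 0 ∧
      (derivative (derivative (derivative g))).eval 0 = 0 := by
  have := natCast_add_two_le_contactOrder hf hg 2
  rw [← coeff_zero_eq_eval_zero, ← coeff_zero_eq_eval_zero, coeff_derivative, coeff_derivative,
    coeff_derivative, coeff_derivative, coeff_derivative]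
  norm_num at this ⊢
  rw [this]
  constructor
  · exact fun h => ⟨h 0 (by norm_num), h 1 (by norm_num)⟩
  · rintro ⟨h0, h1⟩ d hd
    interval_cases d <;> assumption

theorem contactOrder_eq_two (hf : DifferentiableAt ℝ f p)
    (hg : ∀ t : ℝ, f (p + t • v) = g.eval t) :
    contactOrder f p v = 2 ↔ ¬ 3 ≤ contactOrder f p v := by
  have h2 := (natCast_add_two_le_contactOrder hf hg 0).mpr (by simp)
  constructor
  · intro h
    rw [h]
    decide
  · intro h
    refine le_antisymm ?_ h2
    rw [not_le] at h
    exact Order.le_of_lt_add_one h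

theorem three_lt_contactOrder : 3 < contactOrder f p v ↔ 4 ≤ contactOrder f p v := by
  rw [show (4 : ℕ∞) = 3 + 1 by norm_num, ENat.add_one_le_iff (by decide)]

end contact

theorem setOf_span_eq_singleton {α β : ℝ} (h : α ≠ 0 ∨ β ≠ 0) :
    {L | ∃ v : ℝ × ℝ, v ≠ 0 ∧ L = Submodule.span ℝ {v} ∧ α * v.1 + β * v.2 = 0} =
      {Submodule.span ℝ {((β, -α) : ℝ × ℝ)}} := by
  have hpos : 0 < α ^ 2 + β ^ 2 := by
    rcases h with h | h <;> positivity
  ext L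
  simp only [mem_ofPred_eq, mem_singleton_iff]
  constructor
  · rintro ⟨v, hv, rfl, hL⟩
    -- The coordinate of `v` along `(β, -α)`, by orthogonal projection.
    set k := (β * v.1 - α * v.2) / (α ^ 2 + β ^ 2) with hk
    have hvk : v = k • ((β, -α) : ℝ × ℝ) := by
      ext
      · simp only [hk, Prod.smul_fst, smul_eq_mul]
        field_simp
        linear_combination α * hL
      · simp only [hk, Prod.smul_snd, smul_eq_mul]
        field_simp
        linear_combination β * hL
    have hk0 : k ≠ 0 := by
      intro h0
      apply hv
      rw [hvk, h0, zero_smul]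
    rw [hvk, Submodule.span_singleton_smul_eq (IsUnit.mk0 k hk0)]
  · rintro rfl
    refine ⟨_, ?_, rfl, by ring⟩
    rw [Ne, Prod.mk_eq_zero, neg_eq_zero]
    tauto

theorem span_ne_span {α β γ δ : ℝ} (h : α * δ - β * γ ≠ 0) :
    Submodule.span ℝ {((β, -α) : ℝ × ℝ)} ≠ Submodule.span ℝ {((δ, -γ) : ℝ × ℝ)} := by
  intro he
  have hm : ((β, -α) : ℝ × ℝ) ∈ Submodule.span ℝ {((δ, -γ) : ℝ × ℝ)} :=
    he ▸ Submodule.mem_span_singleton_self _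
  obtain ⟨k, hk⟩ := Submodule.mem_span_singleton.mp hm
  simp only [Prod.smul_mk, smul_eq_mul, Prod.mk.injEq] at hk
  apply h
  linear_combination δ * hk.2 + γ * hk.1

section quadratic
variable {A B C : ℝ}

theorem quadratic_ne_zero (h : 0 < A * C - B ^ 2) {v : ℝ × ℝ} (hv : v ≠ 0) :
    A * v.1 ^ 2 + 2 * B * v.1 * v.2 + C * v.2 ^ 2 ≠ 0 := by
  intro h0
  have hC : C ≠ 0 := by
    rintro rfl
    nlinarith [sq_nonneg B]
  have e : (B * v.1 + C * v.2) ^ 2 + (A * C - B ^ 2) * v.1 ^ 2 = 0 := by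
    linear_combination C * h0
  have e1 : v.1 = 0 := by
    by_contra h1
    have : 0 < (A * C - B ^ 2) * v.1 ^ 2 := by positivity
    nlinarith [sq_nonneg (B * v.1 + C * v.2)]
  rw [e1] at e
  have e2 : v.2 = 0 := by simpa [hC] using e
  exact hv (Prod.ext e1 e2)

theorem quadratic_factor (h : A * C - B ^ 2 < 0) :
    ∃ α β γ δ : ℝ, α * δ - β * γ ≠ 0 ∧ ∀ x y : ℝ,
      A * x ^ 2 + 2 * B * x * y + C * y ^ 2 = (α * x + β * y) * (γ * x + δ * y) := by
  by_cases hC : C = 0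
  · subst hC
    refine ⟨1, 0, A, 2 * B, ?_, fun x y => by ring⟩
    have : B ≠ 0 := by rintro rfl; simp at h
    simpa
  · set d := √(B ^ 2 - A * C) with hd
    have hd2 : d ^ 2 = B ^ 2 - A * C := Real.sq_sqrt (by linarith)
    have hdpos : 0 < d := Real.sqrt_pos.mpr (by linarith)
    -- The quadratic formula in `y`; the determinant of the two factors is `2 d`.
    refine ⟨(B + d) / C, 1, B - d, C, ?_, fun x y => ?_⟩
    · rw [div_mul_cancel₀ _ hC]
      linarith
    · field_simp
      linear_combination x ^ 2 * hd2

theorem encard_lines_of_neg (h : A * C - B ^ 2 < 0) :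
    {L | ∃ v : ℝ × ℝ, v ≠ 0 ∧ L = Submodule.span ℝ {v} ∧
      A * v.1 ^ 2 + 2 * B * v.1 * v.2 + C * v.2 ^ 2 = 0}.encard = 2 := by
  obtain ⟨α, β, γ, δ, hne, hf⟩ := quadratic_factor h
  have h1 : α ≠ 0 ∨ β ≠ 0 := by
    by_contra! h0
    simp [h0.1, h0.2] at hne
  have h2 : γ ≠ 0 ∨ δ ≠ 0 := by
    by_contra! h0
    simp [h0.1, h0.2] at hne
  have : {L | ∃ v : ℝ × ℝ, v ≠ 0 ∧ L = Submodule.span ℝ {v} ∧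
      A * v.1 ^ 2 + 2 * B * v.1 * v.2 + C * v.2 ^ 2 = 0} =
      {Submodule.span ℝ {((β, -α) : ℝ × ℝ)}, Submodule.span ℝ {((δ, -γ) : ℝ × ℝ)}} := by
    rw [insert_eq, ← setOf_span_eq_singleton h1, ← setOf_span_eq_singleton h2]
    ext L
    simp only [mem_ofPred_eq, mem_union, hf, mul_eq_zero]
    constructor
    · rintro ⟨v, hv, hL, h | h⟩
      · exact Or.inl ⟨v, hv, hL, h⟩
      · exact Or.inr ⟨v, hv, hL, h⟩
    · rintro (⟨v, hv, hL, h⟩ | ⟨v, hv, hL, h⟩)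
      · exact ⟨v, hv, hL, Or.inl h⟩
      · exact ⟨v, hv, hL, Or.inr h⟩
  rw [this, encard_pair (span_ne_span hne)]

theorem encard_lines_of_eq_zero (h : A * C - B ^ 2 = 0) (h0 : A ≠ 0 ∨ C ≠ 0) :
    {L | ∃ v : ℝ × ℝ, v ≠ 0 ∧ L = Submodule.span ℝ {v} ∧
      A * v.1 ^ 2 + 2 * B * v.1 * v.2 + C * v.2 ^ 2 = 0}.encard = 1 := by
  obtain ⟨α, β, h1, hf⟩ : ∃ α β : ℝ, (α ≠ 0 ∨ β ≠ 0) ∧ ∀ x y : ℝ,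
      A * x ^ 2 + 2 * B * x * y + C * y ^ 2 = 0 ↔ α * x + β * y = 0 := by
    by_cases hC : C = 0
    · subst hC
      have hB : B = 0 := by simpa using h
      have hA : A ≠ 0 := by simpa using h0
      exact ⟨A, 0, Or.inl hA, fun x y => by simp [hB, hA]⟩
    · refine ⟨B, C, Or.inr hC, fun x y => ?_⟩
      have e : C * (A * x ^ 2 + 2 * B * x * y + C * y ^ 2) = (B * x + C * y) ^ 2 := by
        linear_combination x ^ 2 * h
      rw [← pow_eq_zero_iff (a := B * x + C * y) two_ne_zero, ← e, mul_eq_zero, or_iff_right hC]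
  simp_rw [hf]
  rw [setOf_span_eq_singleton h1, encard_singleton]

end quadratic

end HessianTopology

/-! ### The normal form `P(x) (u² - c² x²)` and its Hessian -/

namespace HessianTopology

open Polynomial

/-- The product of the lines `y = (s ± c) x` and of the vertical lines over the roots of `P`. -/
noncomputable def lineProduct (P : ℝ[X]) (s c : ℝ) (p : ℝ × ℝ) : ℝ :=
  P.eval p.1 * ((p.2 - s * p.1) ^ 2 - c ^ 2 * p.1 ^ 2)

/-- The restriction of `lineProduct P s c` to the line `t ↦ p + t • v`. -/
noncomputable def restrictLine (P : ℝ[X]) (s c : ℝ) (p v : ℝ × ℝ) : ℝ[X] :=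
  P.comp (C v.1 * X + C p.1) *
    ((C (v.2 - s * v.1 - c * v.1) * X + C (p.2 - s * p.1 - c * p.1)) *
    (C (v.2 - s * v.1 + c * v.1) * X + C (p.2 - s * p.1 + c * p.1)))

variable (P : ℝ[X]) (s c : ℝ)

theorem lineProduct_add_smul (p v : ℝ × ℝ) (t : ℝ) :
    lineProduct P s c (p + t • v) = (restrictLine P s c p v).eval t := by
  simp only [lineProduct, restrictLine, eval_mul, eval_comp, eval_add, eval_C, eval_X,
    Prod.fst_add, Prod.snd_add, Prod.smul_fst, Prod.smul_snd, smul_eq_mul]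
  rw [show v.1 * t + p.1 = p.1 + t * v.1 by ring]
  ring

theorem contDiff_eval_fst : ContDiff ℝ ∞ fun p : ℝ × ℝ => P.eval p.1 := by
  have h : ContDiff ℝ ∞ fun x : ℝ => P.eval x := by
    simpa using P.contDiff_aeval (𝕜 := ℝ) ∞
  exact h.comp contDiff_fst

theorem contDiff_lineProduct : ContDiff ℝ ∞ (lineProduct P s c) := by
  have := contDiff_eval_fst P
  unfold lineProduct
  fun_prop

theorem differentiable_lineProduct : Differentiable ℝ (lineProduct P s c) :=
  (contDiff_lineProduct P s c).differentiable (by simp)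

theorem dx_lineProduct : dx (lineProduct P s c) = fun p =>
    (derivative P).eval p.1 * ((p.2 - s * p.1) ^ 2 - c ^ 2 * p.1 ^ 2) +
      P.eval p.1 * (2 * (p.2 - s * p.1) * (-s) - c ^ 2 * (2 * p.1)) := by
  funext ⟨x, y⟩
  have h2 : HasDerivAt (fun x => (y - s * x) ^ 2 - c ^ 2 * x ^ 2)
      (2 * (y - s * x) * (-s) - c ^ 2 * (2 * x)) x := by
    have h3 : HasDerivAt (fun x => y - s * x) (-s) x := by
      simpa using ((hasDerivAt_id x).const_mul s).const_sub y
    simpa using (h3.fun_pow 2).fun_sub ((hasDerivAt_pow 2 x).const_mul (c ^ 2))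
  exact ((P.hasDerivAt x).mul h2).deriv

theorem dy_lineProduct : dy (lineProduct P s c) = fun p =>
    P.eval p.1 * (2 * (p.2 - s * p.1)) := by
  funext ⟨x, y⟩
  have h3 : HasDerivAt (fun y => (y - s * x) ^ 2 - c ^ 2 * x ^ 2) (2 * (y - s * x)) y := by
    simpa using (((hasDerivAt_id y).sub_const (s * x)).pow 2).sub_const (c ^ 2 * x ^ 2)
  exact (h3.const_mul (P.eval x)).deriv

theorem dx_dx_lineProduct (p : ℝ × ℝ) : dx (dx (lineProduct P s c)) p =
    (derivative (derivative P)).eval p.1 * ((p.2 - s * p.1) ^ 2 - c ^ 2 * p.1 ^ 2) +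
      2 * (derivative P).eval p.1 * (2 * (p.2 - s * p.1) * (-s) - c ^ 2 * (2 * p.1)) +
      P.eval p.1 * (2 * s ^ 2 - 2 * c ^ 2) := by
  rw [dx_lineProduct]
  obtain ⟨x, y⟩ := p
  have h3 : HasDerivAt (fun x => y - s * x) (-s) x := by
    simpa using ((hasDerivAt_id x).const_mul s).const_sub y
  have h2 : HasDerivAt (fun x => (y - s * x) ^ 2 - c ^ 2 * x ^ 2)
      (2 * (y - s * x) * (-s) - c ^ 2 * (2 * x)) x := by
    simpa using (h3.fun_pow 2).fun_sub ((hasDerivAt_pow 2 x).const_mul (c ^ 2))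
  have h4 : HasDerivAt (fun x => 2 * (y - s * x) * (-s) - c ^ 2 * (2 * x))
      (2 * (-s) * (-s) - c ^ 2 * 2) x := by
    simpa using ((h3.const_mul 2).mul_const (-s)).fun_sub
      (((hasDerivAt_id x).const_mul 2).const_mul (c ^ 2))
  refine ((((derivative P).hasDerivAt x).fun_mul h2).fun_add ((P.hasDerivAt x).fun_mul h4)).deriv.trans ?_
  simp only
  ring

theorem dy_dx_lineProduct (p : ℝ × ℝ) : dy (dx (lineProduct P s c)) p =
    (derivative P).eval p.1 * (2 * (p.2 - s * p.1)) + P.eval p.1 * (-2 * s) := by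
  rw [dx_lineProduct]
  obtain ⟨x, y⟩ := p
  have h0 : HasDerivAt (fun y => y - s * x) 1 y := by
    simpa using (hasDerivAt_id y).sub_const (s * x)
  have h3 : HasDerivAt (fun y => (y - s * x) ^ 2 - c ^ 2 * x ^ 2) (2 * (y - s * x)) y := by
    simpa using (h0.pow 2).sub_const (c ^ 2 * x ^ 2)
  have h4 : HasDerivAt (fun y => 2 * (y - s * x) * (-s) - c ^ 2 * (2 * x)) (-2 * s) y := by
    simpa using ((h0.const_mul 2).mul_const (-s)).sub_const (c ^ 2 * (2 * x))
  exact ((h3.const_mul ((derivative P).eval x)).fun_add (h4.const_mul (P.eval x))).deriv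

theorem dy_dy_lineProduct (p : ℝ × ℝ) : dy (dy (lineProduct P s c)) p = 2 * P.eval p.1 := by
  rw [dy_lineProduct]
  obtain ⟨x, y⟩ := p
  have h3 : HasDerivAt (fun y => 2 * (y - s * x)) 2 y := by
    simpa using ((hasDerivAt_id y).sub_const (s * x)).const_mul 2
  refine (h3.const_mul (P.eval x)).deriv.trans ?_
  simp only
  ring

/-- The shear `(x, y) ↦ (x, u)` preserves the Hessian, and the function is even in `u`; so there is
no term linear in `u`. -/
theorem hess_lineProduct (p : ℝ × ℝ) : hess (lineProduct P s c) p =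
    -2 * (2 * (derivative P).eval p.1 ^ 2 - P.eval p.1 * (derivative (derivative P)).eval p.1) *
      (p.2 - s * p.1) ^ 2 -
    2 * c ^ 2 * (P.eval p.1 * (derivative (derivative (X ^ 2 * P))).eval p.1) := by
  rw [hess, dx_dx_lineProduct, dy_dx_lineProduct, dy_dy_lineProduct]
  simp
  ring

theorem eval_derivative_derivative_restrictLine (p v : ℝ × ℝ) :
    (derivative (derivative (restrictLine P s c p v))).eval 0 =
      dx (dx (lineProduct P s c)) p * v.1 ^ 2 + 2 * dy (dx (lineProduct P s c)) p * v.1 * v.2 +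
        dy (dy (lineProduct P s c)) p * v.2 ^ 2 := by
  rw [dx_dx_lineProduct, dy_dx_lineProduct, dy_dy_lineProduct, restrictLine]
  simp [derivative_comp]
  ring

variable {P s c}

theorem three_le_contactOrder_lineProduct {p v : ℝ × ℝ} :
    3 ≤ contactOrder (lineProduct P s c) p v ↔
      dx (dx (lineProduct P s c)) p * v.1 ^ 2 + 2 * dy (dx (lineProduct P s c)) p * v.1 * v.2 +
        dy (dy (lineProduct P s c)) p * v.2 ^ 2 = 0 := by
  rw [three_le_contactOrder (differentiable_lineProduct P s c p) (lineProduct_add_smul P s c p v),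
    eval_derivative_derivative_restrictLine]

theorem asymptoticLines_lineProduct (p : ℝ × ℝ) : asymptoticLines (lineProduct P s c) p =
    {L | ∃ v : ℝ × ℝ, v ≠ 0 ∧ L = Submodule.span ℝ {v} ∧
      dx (dx (lineProduct P s c)) p * v.1 ^ 2 + 2 * dy (dx (lineProduct P s c)) p * v.1 * v.2 +
        dy (dy (lineProduct P s c)) p * v.2 ^ 2 = 0} := by
  simp only [asymptoticLines, three_le_contactOrder_lineProduct]

theorem isElliptic_of_hess_pos {p : ℝ × ℝ} (h : 0 < hess (lineProduct P s c) p) :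
    IsElliptic (lineProduct P s c) p := by
  intro v hv
  rw [contactOrder_eq_two (differentiable_lineProduct P s c p) (lineProduct_add_smul P s c p v),
    three_le_contactOrder_lineProduct]
  exact quadratic_ne_zero h hv

theorem isHyperbolic_of_hess_neg {p : ℝ × ℝ} (h : hess (lineProduct P s c) p < 0) :
    IsHyperbolic (lineProduct P s c) p := by
  rw [IsHyperbolic, asymptoticLines_lineProduct]
  exact encard_lines_of_neg h

end HessianTopology

/-! ### The Hessian curve under good position -/

namespace HessianTopology

open Polynomial

/-- A nonconstant real-rooted polynomial `P` with simple nonzero roots, none of which is a root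
of the second derivative of `x ^ 2 P`. -/
structure IsAdmissible (P : ℝ[X]) : Prop where
  splits : P.Splits
  natDegree_ne_zero : P.natDegree ≠ 0
  simple : ∀ x, P.eval x = 0 → (derivative P).eval x ≠ 0
  eval_zero : P.eval 0 ≠ 0
  good : ∀ x, P.eval x = 0 → (derivative (derivative (X ^ 2 * P))).eval x ≠ 0

variable {P : ℝ[X]} {s c : ℝ}

namespace IsAdmissible

theorem ne_zero (hP : IsAdmissible P) : P ≠ 0 := by
  rintro rfl
  exact hP.natDegree_ne_zero natDegree_zero

/-- Off the roots this is `P'²` plus the Laguerre expression; at a root it is `2 P'²`. -/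
theorem discr_pos (hP : IsAdmissible P) (x : ℝ) :
    0 < 2 * (derivative P).eval x ^ 2 - P.eval x * (derivative (derivative P)).eval x := by
  by_cases h : P.eval x = 0
  · have := hP.simple x h
    rw [h]
    have : 0 < (derivative P).eval x ^ 2 := by positivity
    linarith
  · have := sq_derivative_sub_pos hP.splits hP.natDegree_ne_zero h
    nlinarith [sq_nonneg ((derivative P).eval x)]

theorem natDegree_X_sq_mul (hP : IsAdmissible P) : (X ^ 2 * P).natDegree = P.natDegree + 2 := by
  rw [natDegree_mul (by simp) hP.ne_zero, natDegree_X_pow, add_comm]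

/-- Descent: a multiple root of `(x² P)''` is a root of `(x² P)'`, hence of `x² P`. At `0` the
second derivative is `2 P(0) ≠ 0`, and roots of `P` are excluded by `good`. -/
theorem simple_second_derivative (hP : IsAdmissible P) {x : ℝ}
    (h : (derivative (derivative (X ^ 2 * P))).eval x = 0) :
    (derivative (derivative (derivative (X ^ 2 * P)))).eval x ≠ 0 := by
  intro h3
  have hs : (X ^ 2 * P).Splits := (Splits.X_pow 2).mul hP.splits
  have hd := hP.natDegree_X_sq_mul
  have h1 := eval_eq_zero_of_derivative (splits_derivative hs)
    (by rw [natDegree_derivative, hd]; omega) h h3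
  have h0 := eval_eq_zero_of_derivative hs (by rw [hd]; omega) h1 h
  rw [eval_mul, eval_pow, eval_X, mul_eq_zero, pow_eq_zero_iff two_ne_zero] at h0
  rcases h0 with rfl | h0
  · have : (derivative (derivative (X ^ 2 * P))).eval 0 = 2 * P.eval 0 := by
      simp
      norm_num
    rw [this] at h
    exact hP.eval_zero (by linarith)
  · exact hP.good x h0 h

theorem derivative_X_mul_simple (hP : IsAdmissible P) {x : ℝ}
    (h : (derivative (X * P)).eval x = 0) : (derivative (derivative (X * P))).eval x ≠ 0 := by
  intro h2
  have hd : (X * P).natDegree = P.natDegree + 1 := by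
    rw [natDegree_mul X_ne_zero hP.ne_zero, natDegree_X, add_comm]
  have h0 := eval_eq_zero_of_derivative (Splits.X.mul hP.splits) (by rw [hd]; omega) h h2
  rw [eval_mul, eval_X, mul_eq_zero] at h0
  simp only [derivative_mul, derivative_X, one_mul, eval_add, eval_mul, eval_X] at h
  rcases h0 with rfl | h0
  · exact hP.eval_zero (by simpa using h)
  · rw [h0, zero_add, mul_eq_zero] at h
    rcases h with rfl | h
    · exact hP.eval_zero h0
    · exact hP.simple x h0 h

/-- The critical points of `x P`. -/
theorem exists_critical (hP : IsAdmissible P) :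
    ∃ U : Finset ℝ, U.card = P.natDegree ∧
      ∀ x, x ∈ U ↔ (derivative (X * P)).eval x = 0 := by
  have hd : (derivative (X * P)).natDegree = P.natDegree := by
    rw [natDegree_derivative, natDegree_mul X_ne_zero hP.ne_zero, natDegree_X]
    omega
  have hne : derivative (X * P) ≠ 0 := by
    intro h
    rw [h, natDegree_zero] at hd
    exact hP.natDegree_ne_zero hd.symm
  obtain ⟨U, h1, h2, -⟩ := exists_finset_roots
    (splits_derivative (Splits.X.mul hP.splits)) hne fun x hx => hP.derivative_X_mul_simple hx
  exact ⟨U, h1.trans hd, h2⟩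

/-- The sign of `P (x ^ 2 P)''` is described by `natDegree P` separated intervals. -/
theorem exists_intervals (hP : IsAdmissible P) :
    ∃ l r : Fin P.natDegree → ℝ, (∀ k, l k < r k) ∧ (∀ k k', k < k' → r k < l k') ∧
      (∀ k, (P * derivative (derivative (X ^ 2 * P))).eval (l k) = 0) ∧
      ∀ x, (P * derivative (derivative (X ^ 2 * P))).eval x ≤ 0 ↔ ∃ k, x ∈ Icc (l k) (r k) := by
  set R2 := derivative (derivative (X ^ 2 * P)) with hR2
  have hd : R2.natDegree = P.natDegree := by
    rw [hR2, natDegree_derivative, natDegree_derivative, hP.natDegree_X_sq_mul]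
    omega
  have hR0 : R2 ≠ 0 := by
    intro h
    rw [h, natDegree_zero] at hd
    exact hP.natDegree_ne_zero hd.symm
  have hsp : R2.Splits :=
    splits_derivative (splits_derivative ((Splits.X_pow 2).mul hP.splits))
  -- Its value is `lc(P)² (N + 1)(N + 2)`; the sign decides that the product is nonpositive inside
  -- the pairs of roots.
  have hlc : 0 < (P * R2).leadingCoeff := by
    rw [leadingCoeff_mul, hR2, leadingCoeff_derivative, leadingCoeff_derivative, leadingCoeff_mul,
      leadingCoeff_X_pow, natDegree_derivative, hP.natDegree_X_sq_mul]
    have hl : P.leadingCoeff ≠ 0 := leadingCoeff_ne_zero.mpr hP.ne_zero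
    have : 0 < P.leadingCoeff ^ 2 := by positivity
    have e : P.natDegree + 2 - 1 = P.natDegree + 1 := by omega
    rw [e]
    push_cast
    have h2 : 0 < P.leadingCoeff ^ 2 * (((P.natDegree : ℝ) + 1) * (P.natDegree + 2)) := by
      positivity
    linarith
  obtain ⟨Z, hZ, hZmem, hprod⟩ := exists_finset_roots (hP.splits.mul hsp)
    (mul_ne_zero hP.ne_zero hR0) (fun x hx => by
      rw [eval_mul, mul_eq_zero] at hx
      rw [derivative_mul, eval_add, eval_mul, eval_mul]
      rcases hx with hx | hx
      · rw [hx, zero_mul, add_zero]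
        exact mul_ne_zero (hP.simple x hx) (hP.good x hx)
      · rw [hx, mul_zero, zero_add]
        exact mul_ne_zero (fun h => hP.good x h hx) (hP.simple_second_derivative hx))
  rw [natDegree_mul hP.ne_zero hR0, hd, ← two_mul] at hZ
  obtain ⟨l, r, hlr, hsep, hmem, hpair⟩ := exists_pairing Z hZ
  refine ⟨l, r, hlr, hsep, fun k => (hZmem _).mp (hmem k).1, fun x => ?_⟩
  rw [hprod, hpair, ← prod_pairs_nonpos_iff hlr hsep]
  constructor
  · intro h
    by_contra! h'
    exact absurd h (not_le.mpr (mul_pos hlc h'))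
  · exact fun h => mul_nonpos_of_nonneg_of_nonpos hlc.le h

/-- The second-order form never vanishes identically on the Hessian curve: `f_yy = 2 P`, and where
`P = 0` the curve forces `u = 0`, so that `f_xx ≠ 0` by `good`. -/
theorem encard_asymptoticLines (hP : IsAdmissible P) (hc : c ≠ 0) {p : ℝ × ℝ}
    (h : hess (lineProduct P s c) p = 0) : (asymptoticLines (lineProduct P s c) p).encard = 1 := by
  rw [asymptoticLines_lineProduct]
  refine encard_lines_of_eq_zero h ?_
  by_cases h0 : P.eval p.1 = 0
  · left
    have hs := hP.simple _ h0
    rw [hess_lineProduct, h0] at h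
    have hu : p.2 - s * p.1 = 0 := by simpa [hs] using h
    have hg := hP.good _ h0
    have e : dx (dx (lineProduct P s c)) p =
        -c ^ 2 * (derivative (derivative (X ^ 2 * P))).eval p.1 := by
      rw [dx_dx_lineProduct, hu, h0]
      simp [h0]
      ring
    rw [e]
    exact mul_ne_zero (neg_ne_zero.mpr (pow_ne_zero 2 hc)) hg
  · right
    rw [dy_dy_lineProduct]
    simpa using h0

theorem parabolicCurve_eq (hP : IsAdmissible P) (hc : c ≠ 0) :
    parabolicCurve (lineProduct P s c) = hessianCurve (lineProduct P s c) := by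
  ext p
  simp only [parabolicCurve, hessianCurve, mem_ofPred_eq]
  constructor
  · rintro ⟨h1, h2⟩
    rcases lt_trichotomy (hess (lineProduct P s c) p) 0 with h | h | h
    · exact absurd (isHyperbolic_of_hess_neg h) h2
    · exact h
    · exact absurd (isElliptic_of_hess_pos h) h1
  · intro h
    have h1 := hP.encard_asymptoticLines hc h
    refine ⟨fun he => ?_, fun hh => ?_⟩
    · obtain ⟨L, hL⟩ := encard_eq_one.mp h1
      obtain ⟨v, hv, -, h3⟩ : L ∈ asymptoticLines (lineProduct P s c) p := hL ▸ mem_singleton L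
      rw [he v hv] at h3
      exact absurd h3 (by decide)
    · rw [IsHyperbolic, h1] at hh
      exact absurd hh (by decide)

/-- If `u ≠ 0`, the `y`-derivative `-4 D u` of the Hessian is nonzero. If `u = 0`, then `Q = 0`, and
the derivative along `(1, s)`, where `u` is constant, is `-2 c² Q'`, nonzero since `Q` has simple
roots. -/
theorem isSmoothCurveAt (hP : IsAdmissible P) (hc : c ≠ 0) {p : ℝ × ℝ}
    (hp : p ∈ hessianCurve (lineProduct P s c)) :
    IsSmoothCurveAt (hessianCurve (lineProduct P s c)) p := by
  set Q := P * derivative (derivative (X ^ 2 * P)) with hQ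
  set D := C 2 * derivative P ^ 2 - P * derivative (derivative P) with hD
  have hG : hess (lineProduct P s c) = fun p =>
      -2 * D.eval p.1 * (p.2 - s * p.1) ^ 2 - 2 * c ^ 2 * Q.eval p.1 := by
    funext p
    rw [hess_lineProduct, hQ, hD]
    simp
  have hcd : ContDiff ℝ ∞ (hess (lineProduct P s c)) := by
    have h1 := contDiff_eval_fst D
    have h2 := contDiff_eval_fst Q
    rw [hG]
    fun_prop
  refine ⟨hp, hess (lineProduct P s c), hcd, ?_, Eventually.of_forall fun q => Iff.rfl⟩
  · intro h0
    have hline : ∀ v : ℝ × ℝ, HasDerivAt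
        (fun t : ℝ => hess (lineProduct P s c) (p + t • v)) 0 0 := fun v => by
      simpa [h0] using hasDerivAt_line (v := v) ((hcd.differentiable (by simp)) p)
    by_cases hu : p.2 - s * p.1 = 0
    · have hQ0 : Q.eval p.1 = 0 := by
        have : hess (lineProduct P s c) p = 0 := hp
        rw [hG] at this
        simpa [hu, hc] using this
      have hQ1 : (derivative Q).eval p.1 ≠ 0 := by
        rw [hQ, eval_mul, mul_eq_zero] at hQ0
        rw [hQ, derivative_mul, eval_add, eval_mul, eval_mul]
        rcases hQ0 with hx | hx
        · rw [hx, zero_mul, add_zero]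
          exact mul_ne_zero (hP.simple _ hx) (hP.good _ hx)
        · rw [hx, mul_zero, zero_add]
          exact mul_ne_zero (fun h => hP.good _ h hx) (hP.simple_second_derivative hx)
      have h1 := hline (1, s)
      have h2 : HasDerivAt (fun t : ℝ => (C (-2 * c ^ 2) * Q.comp (X + C p.1)).eval t)
          ((derivative (C (-2 * c ^ 2) * Q.comp (X + C p.1))).eval 0) 0 :=
        Polynomial.hasDerivAt _ _
      have he : (fun t : ℝ => hess (lineProduct P s c) (p + t • ((1, s) : ℝ × ℝ))) =
          fun t : ℝ => (C (-2 * c ^ 2) * Q.comp (X + C p.1)).eval t := by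
        funext t
        rw [hG]
        have hu' : p.2 + t * s - s * (p.1 + t) = 0 := by linarith
        simp only [Prod.fst_add, Prod.snd_add, Prod.smul_fst, Prod.smul_snd, smul_eq_mul, mul_one,
          eval_mul, eval_C, eval_comp, eval_add, eval_X]
        rw [hu', add_comm t]
        ring
      rw [he] at h1
      have h3 := h1.unique h2
      rw [derivative_C_mul] at h3
      simp [derivative_comp, -map_mul, -map_neg, hc, hQ1] at h3
    · have hDp : D.eval p.1 ≠ 0 := by
        have := hP.discr_pos p.1
        rw [hD]
        simpa using this.ne'
      have h1 := hline (0, 1)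
      have h2 : HasDerivAt (fun t : ℝ => -2 * D.eval p.1 * (t + (p.2 - s * p.1)) ^ 2
          - 2 * c ^ 2 * Q.eval p.1) (-2 * D.eval p.1 * (2 * (0 + (p.2 - s * p.1)))) 0 := by
        simpa using ((((hasDerivAt_id (0 : ℝ)).add_const (p.2 - s * p.1)).fun_pow 2).const_mul
          (-2 * D.eval p.1)).sub_const (2 * c ^ 2 * Q.eval p.1)
      have he : (fun t : ℝ => hess (lineProduct P s c) (p + t • ((0, 1) : ℝ × ℝ))) =
          fun t : ℝ => -2 * D.eval p.1 * (t + (p.2 - s * p.1)) ^ 2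
          - 2 * c ^ 2 * Q.eval p.1 := by
        funext t
        rw [hG]
        simp only [Prod.fst_add, Prod.snd_add, Prod.smul_fst, Prod.smul_snd, smul_eq_mul, mul_one,
          mul_zero, add_zero]
        ring
      rw [he] at h1
      have h3 := h1.unique h2
      simp [hDp, hu] at h3

theorem consistsOfOuterOvals (hP : IsAdmissible P) (hc : c ≠ 0) :
    ConsistsOfOuterOvals (hessianCurve (lineProduct P s c)) P.natDegree := by
  obtain ⟨l, r, hlr, hsep, hl, hiff⟩ := hP.exists_intervals
  set Q := P * derivative (derivative (X ^ 2 * P)) with hQ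
  set D := C 2 * derivative P ^ 2 - P * derivative (derivative P) with hD
  have hDpos : ∀ x, 0 < D.eval x := fun x => by
    have := hP.discr_pos x
    rw [hD]
    simpa using this
  set V : ℝ → ℝ := fun x => -(c ^ 2 * Q.eval x) / D.eval x with hV
  have hVc : Continuous V :=
    ((continuous_const.mul Q.continuous).neg).div D.continuous fun x => (hDpos x).ne'
  have hVl : ∀ k, V (l k) = 0 := fun k => by
    rw [hV]
    simp [hl k]
  have hVi : ∀ x, 0 ≤ V x ↔ ∃ k, x ∈ Icc (l k) (r k) := fun x => by
    have hc2 : 0 < c ^ 2 := by positivity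
    rw [← hiff, hV]
    simp only
    rw [le_div_iff₀ (hDpos x), zero_mul, neg_nonneg]
    constructor
    · intro h
      by_contra! h'
      exact absurd h (not_le.mpr (mul_pos hc2 h'))
    · exact fun h => mul_nonpos_of_nonneg_of_nonpos hc2.le h
  have hC : hessianCurve (lineProduct P s c) = {p | (p.2 - s * p.1) ^ 2 = V p.1} := by
    ext p
    simp only [hessianCurve, mem_ofPred_eq, hV]
    have e : hess (lineProduct P s c) p =
        -2 * (D.eval p.1 * (p.2 - s * p.1) ^ 2 + c ^ 2 * Q.eval p.1) := by
      rw [hess_lineProduct, hQ, hD]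
      simp
      ring
    rw [e, eq_div_iff (hDpos p.1).ne']
    constructor
    · intro h
      linarith
    · intro h
      rw [mul_comm] at h
      rw [h]
      ring
  obtain ⟨h1, h2, h3⟩ := components_of_intervals hVc hlr hsep hVl hVi hC
  exact ⟨h1, fun p hp => hP.isSmoothCurveAt hc hp, h2, h3⟩

end IsAdmissible

end HessianTopology

/-! ### A criterion for a 4-jet not to be a square -/

namespace HessianTopology

open Polynomial

/-- A nonzero `H` is comparable to `t ^ k`, where `k` is the multiplicity of its root at `0`; so the
hypothesis forces `k > n`. -/
theorem coeff_eq_zero_of_isLittleO {H : ℝ[X]} {n : ℕ}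
    (h : (fun t : ℝ => H.eval t) =o[𝓝 0] fun t => t ^ n) : H.coeff n = 0 := by
  by_cases hH : H = 0
  · simp [hH]
  obtain ⟨q, hq, hq0⟩ := exists_eq_pow_rootMultiplicity_mul_and_not_dvd H hH 0
  set k := H.rootMultiplicity 0
  rw [C_0, sub_zero] at hq hq0
  rw [X_dvd_iff, coeff_zero_eq_eval_zero] at hq0
  rcases lt_or_ge n k with hnk | hnk
  · exact X_pow_dvd_iff.mp ⟨q, hq⟩ n hnk
  · exfalso
    have h1 : (fun t : ℝ => t ^ n) =O[𝓝 0] fun t : ℝ => t ^ k := by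
      rw [← Nat.sub_add_cancel hnk]
      simp_rw [pow_add]
      have : (fun t : ℝ => t ^ (n - k)) =O[𝓝 0] fun _ => (1 : ℝ) :=
        (by fun_prop : ContinuousAt (fun t : ℝ => t ^ (n - k)) 0).isBigO_one ℝ
      simpa using this.mul (isBigO_refl (fun t : ℝ => t ^ k) (𝓝 0))
    have h2 : (fun t : ℝ => t ^ k) =O[𝓝 0] fun t : ℝ => H.eval t := by
      have h3 : (fun _ : ℝ => (1 : ℝ)) =O[𝓝 0] fun t : ℝ => q.eval t := by
        have hc : Tendsto (fun t : ℝ => q.eval t) (𝓝 0) (𝓝 (q.eval 0)) := q.continuous.tendsto 0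
        exact (isBigO_const_left_iff_pos_le_norm one_ne_zero).mpr
          ⟨‖q.eval 0‖ / 2, by positivity, by
            filter_upwards [hc.norm.eventually (lt_mem_nhds (half_lt_self (norm_pos_iff.mpr hq0)))]
              with t ht using ht.le⟩
      have h4 := (isBigO_refl (fun t : ℝ => t ^ k) (𝓝 0)).mul h3
      rw [hq]
      simpa using h4
    have h5 := h2.trans_isLittleO (h.trans_isBigO h1)
    refine isLittleO_irrefl ?_ h5
    have : ∃ᶠ t : ℝ in 𝓝 0, t ∈ ({0}ᶜ : Set ℝ) :=
      mem_closure_iff_frequently.mp (by simp [closure_compl])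
    exact this.mono fun t ht => pow_ne_zero k ht

/-- If `f` vanishes on the line `p + t v` and the coefficient of `w t ^ 2` in its expansion along
the parabolas `p + t v ± t ^ 2 w` does not vanish, then the 4-jet of `f` is not a square. -/
theorem not_isSquareFourJet {f : ℝ × ℝ → ℝ} {p v w : ℝ × ℝ} {Γ : ℝ[X]}
    (hf : DifferentiableAt ℝ f p) (hv : ∀ t : ℝ, f (p + t • v) = 0)
    (hΓ : ∀ t : ℝ, f (p + (t • v + t ^ 2 • w)) - f (p + (t • v - t ^ 2 • w)) = t ^ 2 * Γ.eval t)
    (h2 : Γ.coeff 2 ≠ 0) : ¬ IsSquareFourJet f p := by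
  rintro ⟨c, q, hq, hO⟩
  have hp0 : f p = 0 := by simpa using hv 0
  have hdv : fderiv ℝ f p v = 0 := by
    have h1 := hasDerivAt_line (v := v) hf
    simp_rw [hv] at h1
    exact h1.unique (hasDerivAt_const _ _)
  set E : ℝ × ℝ → ℝ := fun h => f (p + h) - (f p + fderiv ℝ f p h) - c * q h ^ 2 with hE
  -- the error term along a curve `t v + σ t ^ 2 w`
  have hcurve : ∀ σ : ℝ, Tendsto (fun t : ℝ => t • v + (σ * t ^ 2) • w) (𝓝 0) (𝓝 0) := by
    intro σ
    have : Continuous fun t : ℝ => t • v + (σ * t ^ 2) • w := by fun_prop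
    simpa using this.tendsto 0
  have hcurveO : ∀ σ : ℝ, (fun t : ℝ => t • v + (σ * t ^ 2) • w) =O[𝓝 0] fun t : ℝ => t := by
    intro σ
    have h1 : (fun t : ℝ => v + (σ * t) • w) =O[𝓝 0] fun _ => (1 : ℝ) :=
      (by fun_prop : ContinuousAt (fun t : ℝ => v + (σ * t) • w) 0).isBigO_one ℝ
    have h3 := (isBigO_refl (fun t : ℝ => t) (𝓝 0)).smul h1
    refine (h3.congr_left fun t => ?_).congr_right fun t => ?_
    · rw [smul_add, smul_smul]
      congr 2
      ring
    · simp
  have hEO : ∀ σ : ℝ, (fun t : ℝ => E (t • v + (σ * t ^ 2) • w)) =o[𝓝 0] fun t : ℝ => t ^ 4 := by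
    intro σ
    have h1 := hO.comp_tendsto (hcurve σ)
    have h3 : (fun t : ℝ => t ^ 5) =o[𝓝 0] fun t : ℝ => t ^ 4 :=
      isLittleO_pow_pow (by norm_num)
    exact (h1.trans ((hcurveO σ).norm_left.pow 5)).trans_isLittleO h3
  -- If `c ≠ 0`, then `f = 0` on the line makes `q` of size `o(t²)` there, so `q = ±t² dq(w) +
  -- o(t²)` on the two parabolas. The sum of the two values is `o(t²)` and the difference `O(t²)`.
  have key : (fun t : ℝ => c * (q (t • v + t ^ 2 • w) ^ 2 - q (t • v - t ^ 2 • w) ^ 2))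
      =o[𝓝 0] fun t : ℝ => t ^ 4 := by
    by_cases hc : c = 0
    · simp [hc]
    have hq0 : (fun t : ℝ => q (t • v)) =o[𝓝 0] fun t : ℝ => t ^ 2 := by
      refine IsLittleO.of_pow (n := 2) ?_ two_ne_zero
      have h1 := (hEO 0).const_mul_left (-c⁻¹)
      refine (h1.congr_left fun t => ?_).congr_right fun t => ?_
      · simp only [hE, zero_mul, zero_smul, add_zero, hv, hp0, map_smul, hdv, smul_zero, Pi.pow_apply]
        field_simp
        ring
      · simp only [Pi.pow_apply]
        ring
    -- Strictness is needed to compare `q` at two moving points, on the line and on the parabola.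
    have hstrict : HasStrictFDerivAt q (fderiv ℝ q 0) 0 :=
      hq.contDiffAt.hasStrictFDerivAt (by simp)
    have hσ : ∀ σ : ℝ, (fun t : ℝ => q (t • v + (σ * t ^ 2) • w) - σ * t ^ 2 * fderiv ℝ q 0 w)
        =o[𝓝 0] fun t : ℝ => t ^ 2 := by
      intro σ
      have ht : Tendsto (fun t : ℝ => (t • v + (σ * t ^ 2) • w, t • v)) (𝓝 0)
          (𝓝 ((0, 0) : (ℝ × ℝ) × (ℝ × ℝ))) := by
        refine (hcurve σ).prodMk_nhds ?_
        simpa using hcurve 0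
      have h1 := hstrict.isLittleO.comp_tendsto ht
      have h3 : (fun t : ℝ => (σ * t ^ 2) • w) =O[𝓝 0] fun t : ℝ => t ^ 2 := by
        have h5 : (fun _ : ℝ => w) =O[𝓝 0] fun _ => (1 : ℝ) :=
          isBigO_const_const w one_ne_zero _
        exact (((isBigO_refl (fun t : ℝ => t ^ 2) (𝓝 0)).const_mul_left σ).smul h5).congr_right
          fun t => by simp
      have h4 := (h1.trans_isBigO ((h3.congr_left fun t => by simp))).add hq0
      refine h4.congr_left fun t => ?_
      simp only [Function.comp_apply, add_sub_cancel_left, map_smul, smul_eq_mul]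
      ring
    have hp := hσ 1
    have hm := hσ (-1)
    have hsum := hp.add hm
    have hdiff : (fun t : ℝ => q (t • v + (1 * t ^ 2) • w) - q (t • v + (-1 * t ^ 2) • w))
        =O[𝓝 0] fun t : ℝ => t ^ 2 := by
      have h1 := (hp.sub hm).isBigO.add
        ((isBigO_refl (fun t : ℝ => t ^ 2) (𝓝 0)).const_mul_left (2 * fderiv ℝ q 0 w))
      refine h1.congr_left fun t => ?_
      ring
    refine (((hsum.mul_isBigO hdiff).const_mul_left c).congr_left fun t => ?_).congr_right
      fun t => ?_
    · simp only [one_mul, neg_mul, neg_smul, ← sub_eq_add_neg]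
      ring
    · ring
  -- The differential of `f` changes only the constant coefficient of `Γ`.
  have hmain : (fun t : ℝ => (X ^ 2 * (Γ - C (2 * fderiv ℝ f p w))).eval t)
      =o[𝓝 0] fun t : ℝ => t ^ 4 := by
    refine (((hEO 1).sub (hEO (-1))).add key).congr_left fun t => ?_
    have := hΓ t
    simp only [hE, one_mul, neg_mul, neg_smul, ← sub_eq_add_neg, map_add, map_sub, map_smul,
      smul_eq_mul, eval_mul, eval_sub, eval_pow, eval_X, eval_C]
    linear_combination this
  have h4 := coeff_eq_zero_of_isLittleO hmain
  rw [show 4 = 2 + 2 by norm_num, coeff_X_pow_mul, coeff_sub, coeff_C_succ, sub_zero] at h4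
  exact h2 h4

end HessianTopology

/-! ### High contact, inflexions and special parabolic points -/

namespace HessianTopology

open Polynomial

variable {P : ℝ[X]} {s c : ℝ}

theorem lineProduct_eq_zero_iff {p : ℝ × ℝ} :
    lineProduct P s c p = 0 ↔ P.eval p.1 = 0 ∨ (p.2 - s * p.1) ^ 2 = c ^ 2 * p.1 ^ 2 := by
  rw [lineProduct, mul_eq_zero, sub_eq_zero]

theorem splits_comp_linear (hP : P.Splits) (a b : ℝ) : (P.comp (C a * X + C b)).Splits := by
  by_cases ha : a = 0
  · rw [ha, C_0, zero_mul, zero_add, comp_C]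
    exact Splits.C _
  · refine hP.comp_of_natDegree_le_one_of_invertible natDegree_linear_le ?_
    rw [leadingCoeff_linear ha]
    exact invertibleOfNonzero ha

theorem splits_linear (a b : ℝ) : (C a * X + C b).Splits := by
  simpa using splits_comp_linear Splits.X a b

theorem splits_restrictLine (hP : P.Splits) (p v : ℝ × ℝ) : (restrictLine P s c p v).Splits :=
  (splits_comp_linear hP _ _).mul ((splits_linear _ _).mul (splits_linear _ _))

/-- A vertical direction is transverse to both slanted lines; any other one is transverse to the
vertical lines and to at least one slanted line. -/
theorem two_le_natDegree_restrictLine (hP : P.natDegree ≠ 0) (hc : c ≠ 0) {p v : ℝ × ℝ}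
    (hv : v ≠ 0) (h0 : restrictLine P s c p v ≠ 0) : 2 ≤ (restrictLine P s c p v).natDegree := by
  have h0' := h0
  rw [restrictLine, mul_ne_zero_iff, mul_ne_zero_iff] at h0'
  obtain ⟨h1, h2, h3⟩ := h0'
  rw [restrictLine, natDegree_mul h1 (mul_ne_zero h2 h3), natDegree_mul h2 h3, natDegree_comp]
  by_cases hv1 : v.1 = 0
  · have hv2 : v.2 ≠ 0 := fun h => hv (Prod.ext hv1 h)
    have e : ∀ b : ℝ, (C v.2 * X + C b).natDegree = 1 := fun b => natDegree_linear hv2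
    simp only [hv1, mul_zero, sub_zero, add_zero, e]
    omega
  · rw [natDegree_linear hv1]
    by_cases hm : v.2 - s * v.1 - c * v.1 = 0
    · have hp : v.2 - s * v.1 + c * v.1 ≠ 0 := by
        intro h
        have : c * v.1 = 0 := by linarith
        simp [hc, hv1] at this
      rw [natDegree_linear hp]
      omega
    · rw [natDegree_linear hm]
      omega

namespace IsAdmissible

theorem lineProduct_eq_zero_of_contact (hP : IsAdmissible P) (hc : c ≠ 0) {p v : ℝ × ℝ}
    (hv : v ≠ 0) (h : 4 ≤ contactOrder (lineProduct P s c) p v) : lineProduct P s c p = 0 := by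
  rw [four_le_contactOrder (differentiable_lineProduct P s c p)
    (lineProduct_add_smul P s c p v)] at h
  have he : lineProduct P s c p = (restrictLine P s c p v).eval 0 := by
    rw [← lineProduct_add_smul, zero_smul, add_zero]
  rw [he]
  by_cases h0 : restrictLine P s c p v = 0
  · rw [h0, Polynomial.eval_zero]
  have hd := two_le_natDegree_restrictLine hP.natDegree_ne_zero hc hv h0
  have hs := splits_restrictLine (s := s) (c := c) hP.splits p v
  have h1 := eval_eq_zero_of_derivative (splits_derivative hs)
    (by rw [natDegree_derivative]; omega) h.1 h.2
  exact eval_eq_zero_of_derivative hs (by omega) h1 h.1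

end IsAdmissible

theorem four_le_contactOrder_of_line {p v : ℝ × ℝ}
    (h : ∀ t : ℝ, lineProduct P s c (p + t • v) = 0) :
    4 ≤ contactOrder (lineProduct P s c) p v := by
  rw [four_le_contactOrder (differentiable_lineProduct P s c p) (g := 0) (fun t => by simp [h])]
  simp

/-- The slope of a line of the zero set through `p`, off the vertical lines. -/
theorem exists_slope {p : ℝ × ℝ} (h : (p.2 - s * p.1) ^ 2 = c ^ 2 * p.1 ^ 2) :
    ∃ d, d ^ 2 = c ^ 2 ∧ p.2 - s * p.1 = d * p.1 := by
  rw [← mul_pow, sq_eq_sq_iff_eq_or_eq_neg] at h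
  rcases h with h | h
  · exact ⟨c, rfl, h⟩
  · exact ⟨-c, by ring, by linarith⟩

theorem lineProduct_vertical {p : ℝ × ℝ} (h : P.eval p.1 = 0) (t : ℝ) :
    lineProduct P s c (p + t • ((0, 1) : ℝ × ℝ)) = 0 := by
  simp [lineProduct, h]

theorem lineProduct_slope {p : ℝ × ℝ} {d : ℝ} (hd : d ^ 2 = c ^ 2)
    (h : p.2 - s * p.1 = d * p.1) (t : ℝ) :
    lineProduct P s c (p + t • ((1, s + d) : ℝ × ℝ)) = 0 := by
  rw [lineProduct_eq_zero_iff]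
  right
  simp only [Prod.fst_add, Prod.snd_add, Prod.smul_fst, Prod.smul_snd, smul_eq_mul, mul_one]
  rw [← hd, show p.2 + t * (s + d) - s * (p.1 + t) = d * (p.1 + t) by linear_combination h]
  ring

theorem exists_line_of_eq_zero {p : ℝ × ℝ} (h : lineProduct P s c p = 0) :
    ∃ v : ℝ × ℝ, v ≠ 0 ∧ ∀ t : ℝ, lineProduct P s c (p + t • v) = 0 := by
  rcases lineProduct_eq_zero_iff.mp h with h | h
  · exact ⟨(0, 1), by simp, lineProduct_vertical h⟩
  · obtain ⟨d, hd, h⟩ := exists_slope h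
    exact ⟨(1, s + d), by simp, lineProduct_slope hd h⟩

/-- The Hessian is minus a square because the second-order form vanishes along a zero line; likewise
in `hess_of_sq_eq`. -/
theorem hess_of_eval_eq_zero {p : ℝ × ℝ} (h : P.eval p.1 = 0) :
    hess (lineProduct P s c) p = -(2 * (derivative P).eval p.1 * (p.2 - s * p.1)) ^ 2 := by
  rw [hess_lineProduct, h]
  ring

theorem hess_of_sq_eq {p : ℝ × ℝ} (h : (p.2 - s * p.1) ^ 2 = c ^ 2 * p.1 ^ 2) :
    hess (lineProduct P s c) p = -(2 * c * (derivative (X * P)).eval p.1) ^ 2 := by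
  rw [hess_lineProduct, h]
  simp
  ring

namespace IsAdmissible

theorem overContactSet_eq (hP : IsAdmissible P) (hc : c ≠ 0) :
    overContactSet (lineProduct P s c) = {p | lineProduct P s c p = 0} := by
  ext p
  simp only [overContactSet, mem_ofPred_eq, three_lt_contactOrder]
  constructor
  · rintro ⟨v, hv, h⟩
    exact hP.lineProduct_eq_zero_of_contact hc hv h
  · intro h
    obtain ⟨v, hv, h⟩ := exists_line_of_eq_zero h
    exact ⟨v, hv, four_le_contactOrder_of_line h⟩

theorem derivative_X_mul_ne_zero (hP : IsAdmissible P) : derivative (X * P) ≠ 0 := by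
  intro h
  have h1 := hP.derivative_X_mul_simple (x := 0) (by simp [h])
  simp [h] at h1

/-- On a zero line the Hessian is negative except at finitely many points, so every point of the
line is a limit of inflexion points on it. -/
theorem inflexionCurve_eq (hP : IsAdmissible P) (hc : c ≠ 0) :
    inflexionCurve (lineProduct P s c) = {p | lineProduct P s c p = 0} := by
  apply Subset.antisymm
  · refine closure_minimal ?_ (isClosed_singleton.preimage
      (differentiable_lineProduct P s c).continuous)
    rintro p ⟨-, h⟩
    rw [← hP.overContactSet_eq hc]
    exact h
  · intro p hp
    have key : ∀ v : ℝ × ℝ, v ≠ 0 → (∀ t : ℝ, lineProduct P s c (p + t • v) = 0) →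
        (∀ᶠ t : ℝ in 𝓝[≠] 0, hess (lineProduct P s c) (p + t • v) < 0) →
        p ∈ inflexionCurve (lineProduct P s c) := by
      intro v hv h0 hh
      have hlim : Tendsto (fun t : ℝ => p + t • v) (𝓝[≠] 0) (𝓝 p) := by
        have hcont : Continuous fun t : ℝ => p + t • v := by fun_prop
        have := (hcont.tendsto 0).mono_left (nhdsWithin_le_nhds (s := {0}ᶜ))
        simpa using this
      refine mem_closure_of_tendsto hlim (hh.mono fun t ht => ⟨isHyperbolic_of_hess_neg ht, ?_⟩)
      have : p + t • v ∈ overContactSet (lineProduct P s c) := by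
        rw [hP.overContactSet_eq hc]
        exact h0 t
      exact this
    rcases lineProduct_eq_zero_iff.mp hp with h | h
    · refine key (0, 1) (by simp) (lineProduct_vertical h) ?_
      have hfin := nhdsNE_le_cofinite (0 : ℝ)
        ((finite_singleton (-(p.2 - s * p.1))).compl_mem_cofinite)
      filter_upwards [hfin] with t ht
      rw [hess_of_eval_eq_zero (by simpa using h)]
      have h1 := hP.simple _ h
      have h2 : p.2 + t - s * p.1 ≠ 0 := fun h => ht (by
        rw [mem_singleton_iff]
        linarith)
      simp only [Prod.fst_add, Prod.snd_add, Prod.smul_fst, Prod.smul_snd, smul_eq_mul, mul_one,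
        mul_zero, add_zero]
      have : 2 * (derivative P).eval p.1 * (p.2 + t - s * p.1) ≠ 0 :=
        mul_ne_zero (mul_ne_zero two_ne_zero h1) h2
      have := pow_pos (abs_pos.mpr this) 2
      rw [sq_abs] at this
      linarith
    · obtain ⟨d, hd, h'⟩ := exists_slope h
      refine key (1, s + d) (by simp) (lineProduct_slope hd h') ?_
      set H := (derivative (X * P)).comp (X + C p.1) with hH
      have hH0 : H ≠ 0 := by
        rw [hH, Ne, comp_X_add_C_eq_zero_iff]
        exact hP.derivative_X_mul_ne_zero
      have hfin := nhdsNE_le_cofinite (0 : ℝ) (H.roots.toFinset.finite_toSet.compl_mem_cofinite)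
      filter_upwards [hfin] with t ht
      have hz := (lineProduct_slope (P := P) hd h' t)
      have h1 : (derivative (X * P)).eval (p.1 + t) ≠ 0 := by
        intro h0
        apply ht
        simp only [Finset.mem_coe, Multiset.mem_toFinset, mem_roots hH0, IsRoot.def]
        rw [hH, eval_comp, eval_add, eval_X, eval_C, add_comm, h0]
      rw [hess_of_sq_eq]
      · simp only [Prod.fst_add, Prod.smul_fst, smul_eq_mul, mul_one]
        have : 2 * c * (derivative (X * P)).eval (p.1 + t) ≠ 0 :=
          mul_ne_zero (mul_ne_zero two_ne_zero hc) h1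
        have := pow_pos (abs_pos.mpr this) 2
        rw [sq_abs] at this
        linarith
      · simp only [Prod.fst_add, Prod.snd_add, Prod.smul_fst, Prod.smul_snd, smul_eq_mul, mul_one]
        rw [← hd, show p.2 + t * (s + d) - s * (p.1 + t) = d * (p.1 + t) by
          linear_combination h']
        ring

theorem not_isSquareFourJet_vertical (hP : IsAdmissible P) {p : ℝ × ℝ} (h : P.eval p.1 = 0)
    (hu : p.2 - s * p.1 = 0) : ¬ IsSquareFourJet (lineProduct P s c) p := by
  obtain ⟨P1, hP1⟩ := dvd_iff_isRoot.mpr h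
  have h1 : P1.eval p.1 ≠ 0 := by
    have := hP.simple _ h
    rw [hP1] at this
    simpa [derivative_mul] using this
  -- With this `w`, `u = ±t²·0 + t` on both parabolas. The terms of `Γ` containing `c²` add up to an
  -- even function of `t²`, so the coefficient of `t²` is `2 P1(p.1)`.
  refine not_isSquareFourJet (v := (0, 1)) (w := (1, s))
    (Γ := P1.comp (X ^ 2 + C p.1) * (X ^ 2 - C (c ^ 2) * (C p.1 + X ^ 2) ^ 2) +
      P1.comp (-X ^ 2 + C p.1) * (X ^ 2 - C (c ^ 2) * (C p.1 - X ^ 2) ^ 2))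
    (differentiable_lineProduct P s c p) (lineProduct_vertical h) (fun t => ?_) ?_
  · have e : ∀ x, P.eval x = (x - p.1) * P1.eval x := fun x => by
      conv_lhs => rw [hP1]
      simp
    simp only [lineProduct, Prod.fst_add, Prod.snd_add, Prod.fst_sub, Prod.snd_sub, Prod.smul_fst,
      Prod.smul_snd, smul_eq_mul, mul_one, mul_zero, zero_add, zero_sub, e, eval_add, eval_mul,
      eval_sub, eval_comp, eval_neg, eval_pow, eval_X, eval_C]
    rw [show p.2 + (t + t ^ 2 * s) - s * (p.1 + t ^ 2) = t by linear_combination hu,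
      show p.2 + (t - t ^ 2 * s) - s * (p.1 + -t ^ 2) = t by linear_combination hu,
      add_comm (t ^ 2) p.1, add_comm (-t ^ 2) p.1]
    ring
  · intro h2
    have h3 : ∀ Γ : ℝ[X], Γ.coeff 2 * 2 = (derivative (derivative Γ)).eval 0 := fun Γ => by
      rw [← coeff_zero_eq_eval_zero, coeff_derivative, coeff_derivative]
      norm_num
    have h4 := congrArg (· * (2 : ℝ)) h2
    simp only [h3, zero_mul] at h4
    simp [derivative_comp, derivative_mul, derivative_pow, -map_pow] at h4
    apply h1
    linarith

theorem not_isSquareFourJet_slope (hP : IsAdmissible P) (hc : c ≠ 0) {p : ℝ × ℝ}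
    (h : (p.2 - s * p.1) ^ 2 = c ^ 2 * p.1 ^ 2) (hx : (derivative (X * P)).eval p.1 = 0) :
    ¬ IsSquareFourJet (lineProduct P s c) p := by
  obtain ⟨d, hd, hu⟩ := exists_slope h
  have hd0 : d ≠ 0 := by
    rintro rfl
    exact hc (by simpa using hd.symm)
  -- On the parabolas `u = d x ± t²`, and the difference of squares is `4 d x t²`. The tested
  -- coefficient is thus `2 d (x P)''`, nonzero at a critical point of `x P`.
  refine not_isSquareFourJet (v := (1, s + d)) (w := (0, 1))
    (Γ := C (4 * d) * (X * P).comp (X + C p.1))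
    (differentiable_lineProduct P s c p) (lineProduct_slope hd hu) (fun t => ?_) ?_
  · simp only [lineProduct, Prod.fst_add, Prod.snd_add, Prod.fst_sub, Prod.snd_sub, Prod.smul_fst,
      Prod.smul_snd, smul_eq_mul, mul_one, mul_zero, add_zero, sub_zero, eval_add, eval_mul,
      eval_comp, eval_X, eval_C, ← hd]
    rw [show p.2 + (t * (s + d) + t ^ 2) - s * (p.1 + t) = d * (p.1 + t) + t ^ 2 by
        linear_combination hu,
      show p.2 + (t * (s + d) - t ^ 2) - s * (p.1 + t) = d * (p.1 + t) - t ^ 2 by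
        linear_combination hu, add_comm t p.1]
    ring
  · intro h2
    have h3 : ∀ Γ : ℝ[X], Γ.coeff 2 * 2 = (derivative (derivative Γ)).eval 0 := fun Γ => by
      rw [← coeff_zero_eq_eval_zero, coeff_derivative, coeff_derivative]
      norm_num
    have h4 := congrArg (· * (2 : ℝ)) h2
    simp only [h3, zero_mul] at h4
    have h5 : ∀ (Q : ℝ[X]) (a : ℝ), derivative (Q.comp (X + C a)) = (derivative Q).comp (X + C a) :=
      fun Q a => by simp [derivative_comp]
    rw [derivative_C_mul, derivative_C_mul, h5, h5, eval_mul, eval_C, eval_comp, eval_add, eval_X, eval_C, zero_add] at h4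
    exact mul_ne_zero (mul_ne_zero four_ne_zero hd0) (hP.derivative_X_mul_simple hx) h4

/-- Special points are the parabolic points on the zero set: the zero line through such a point is
its only asymptotic line. -/
theorem isSpecialParabolic_iff (hP : IsAdmissible P) (hc : c ≠ 0) {p : ℝ × ℝ} :
    IsSpecialParabolic (lineProduct P s c) p ↔
      (P.eval p.1 = 0 ∧ p.2 - s * p.1 = 0) ∨
      ((derivative (X * P)).eval p.1 = 0 ∧ (p.2 - s * p.1) ^ 2 = c ^ 2 * p.1 ^ 2) := by
  rw [IsSpecialParabolic, hP.parabolicCurve_eq hc]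
  constructor
  · rintro ⟨h0, -, -, h1, h4⟩
    have h0 : hess (lineProduct P s c) p = 0 := h0
    obtain ⟨L, hL⟩ := encard_eq_one.mp h1
    obtain ⟨v, hv, -, h3⟩ : L ∈ asymptoticLines (lineProduct P s c) p := hL ▸ mem_singleton L
    rcases lineProduct_eq_zero_iff.mp (hP.lineProduct_eq_zero_of_contact hc hv (h4 v hv h3))
      with h | h
    · rw [hess_of_eval_eq_zero h] at h0
      exact Or.inl ⟨h, by simpa [hP.simple _ h] using h0⟩
    · rw [hess_of_sq_eq h, neg_eq_zero, pow_eq_zero_iff two_ne_zero] at h0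
      exact Or.inr ⟨(mul_eq_zero.mp h0).resolve_left (mul_ne_zero two_ne_zero hc), h⟩
  · intro h
    have hz : lineProduct P s c p = 0 :=
      lineProduct_eq_zero_iff.mpr (h.imp And.left And.right)
    have h0 : hess (lineProduct P s c) p = 0 := by
      rcases h with ⟨h, hu⟩ | ⟨h, hu⟩
      · rw [hess_of_eval_eq_zero h, hu]
        ring
      · rw [hess_of_sq_eq hu, h]
        ring
    have h1 := hP.encard_asymptoticLines hc h0
    refine ⟨h0, hP.isSmoothCurveAt hc h0, ?_, h1, fun v hv h3 => ?_⟩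
    · rcases h with ⟨h, hu⟩ | ⟨h, hu⟩
      · exact hP.not_isSquareFourJet_vertical h hu
      · exact hP.not_isSquareFourJet_slope hc hu h
    · obtain ⟨w, hw, hline⟩ := exists_line_of_eq_zero hz
      obtain ⟨L, hL⟩ := encard_eq_one.mp h1
      have hvL : Submodule.span ℝ {v} ∈ asymptoticLines (lineProduct P s c) p :=
        ⟨v, hv, rfl, h3⟩
      have hwL : Submodule.span ℝ {w} ∈ asymptoticLines (lineProduct P s c) p :=
        ⟨w, hw, rfl, le_trans (by norm_num) (four_le_contactOrder_of_line hline)⟩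
      rw [hL, mem_singleton_iff] at hvL hwL
      have hvw : v ∈ Submodule.span ℝ {w} :=
        hwL ▸ hvL ▸ Submodule.mem_span_singleton_self v
      obtain ⟨k, rfl⟩ := Submodule.mem_span_singleton.mp hvw
      exact four_le_contactOrder_of_line fun t => by
        rw [smul_smul]
        exact hline _

/-- The points lie on the lines of slopes `s`, `s + c`, `s - c` through the origin, which is
excluded since `(x P)'(0) = P(0) ≠ 0`; so the three families are disjoint. -/
theorem encard_isSpecialParabolic (hP : IsAdmissible P) (hc : c ≠ 0) :
    {p | IsSpecialParabolic (lineProduct P s c) p}.encard = (3 * P.natDegree : ℕ) := by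
  obtain ⟨U, hU, hUmem⟩ := hP.exists_critical
  obtain ⟨S, hS, hSmem, -⟩ := exists_finset_roots hP.splits hP.ne_zero hP.simple
  have hU0 : ∀ x ∈ U, x ≠ 0 := by
    rintro x hx rfl
    rw [hUmem] at hx
    exact hP.eval_zero (by simpa using hx)
  have hset : {p | IsSpecialParabolic (lineProduct P s c) p} =
      ((fun x => (x, s * x)) '' (S : Set ℝ)) ∪
        (((fun x => (x, (s + c) * x)) '' (U : Set ℝ)) ∪
        ((fun x => (x, (s - c) * x)) '' (U : Set ℝ))) := by
    ext ⟨x, y⟩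
    simp only [mem_ofPred_eq, hP.isSpecialParabolic_iff hc, mem_union, mem_image, Finset.mem_coe,
      hSmem, hUmem, Prod.mk.injEq, existsAndEq, true_and]
    have e : (y - s * x) ^ 2 = c ^ 2 * x ^ 2 ↔ (s + c) * x = y ∨ (s - c) * x = y := by
      rw [← mul_pow, sq_eq_sq_iff_eq_or_eq_neg]
      constructor
      · rintro (h | h)
        · left; linarith
        · right; linarith
      · rintro (h | h)
        · left; linarith
        · right; linarith
    rw [e, and_or_left, sub_eq_zero, eq_comm (a := y)]
  have hinj : ∀ (k : ℝ) (T : Set ℝ), ((fun x => (x, k * x)) '' T).encard = T.encard :=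
    fun k T => InjOn.encard_image fun a _ b _ h => (Prod.mk.inj h).1
  have hne : ∀ {k k' x : ℝ}, x ≠ 0 → k - k' ≠ 0 → k' * x ≠ k * x := by
    intro k k' x hx hk h
    exact mul_ne_zero hk hx (by linarith)
  rw [hset, encard_union_eq, encard_union_eq, hinj, hinj, hinj, encard_coe_eq_coe_finsetCard,
    encard_coe_eq_coe_finsetCard, hU, hS]
  · norm_cast
    ring
  · rw [disjoint_left]
    rintro _ ⟨x, hx, rfl⟩ ⟨x', hx', h⟩
    obtain ⟨rfl, h⟩ := Prod.mk.inj h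
    refine hne (hU0 _ hx) ?_ h
    rw [add_sub_sub_cancel, ← two_mul]
    exact mul_ne_zero two_ne_zero hc
  · rw [disjoint_left]
    rintro _ ⟨x, hx, rfl⟩ (⟨x', hx', h⟩ | ⟨x', hx', h⟩)
    · obtain ⟨rfl, h⟩ := Prod.mk.inj h
      exact hne (hU0 _ hx') (by simpa using hc) h
    · obtain ⟨rfl, h⟩ := Prod.mk.inj h
      exact hne (hU0 _ hx') (by simpa using hc) h

end IsAdmissible

end HessianTopology

/-! ### From good position to admissibility -/

namespace HessianTopology

open Polynomial

section rootFamily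
variable {ι : Type*} [Fintype ι] {ρ : ι → ℝ}

/-- The monic polynomial with a given family of roots. -/
noncomputable def rootPolynomial (ρ : ι → ℝ) : ℝ[X] := ∏ k, (X - C (ρ k))

theorem eval_rootPolynomial (x : ℝ) : (rootPolynomial ρ).eval x = ∏ k, (x - ρ k) := by
  simp [rootPolynomial, eval_prod]

theorem natDegree_rootPolynomial : (rootPolynomial ρ).natDegree = Fintype.card ι := by
  rw [rootPolynomial, natDegree_prod_of_monic _ _ fun k _ => monic_X_sub_C _]
  simp

theorem rootPolynomial_eq_mul [DecidableEq ι] (ρ : ι → ℝ) (k : ι) :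
    rootPolynomial ρ = (X - C (ρ k)) * ∏ j ∈ Finset.univ.erase k, (X - C (ρ j)) :=
  (Finset.mul_prod_erase _ _ (Finset.mem_univ k)).symm

theorem exists_of_eval_rootPolynomial {x : ℝ} (h : (rootPolynomial ρ).eval x = 0) :
    ∃ k, x = ρ k := by
  rw [eval_rootPolynomial, Finset.prod_eq_zero_iff] at h
  obtain ⟨k, -, hk⟩ := h
  exact ⟨k, by linarith⟩

theorem isAdmissible_rootPolynomial [DecidableEq ι] [Nonempty ι] (hinj : Function.Injective ρ) (h0 : ∀ k, ρ k ≠ 0)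
    (hgood : ∀ k, (derivative (derivative (X ^ 2 * rootPolynomial ρ))).eval (ρ k) ≠ 0) :
    IsAdmissible (rootPolynomial ρ) where
  splits := Splits.prod fun k _ => Splits.X_sub_C _
  natDegree_ne_zero := by
    rw [natDegree_rootPolynomial]
    exact Fintype.card_ne_zero
  simple x hx := by
    obtain ⟨k, rfl⟩ := exists_of_eval_rootPolynomial hx
    rw [rootPolynomial_eq_mul ρ k]
    simp only [derivative_mul, derivative_sub, derivative_X, derivative_C, sub_zero, one_mul,
      eval_add, eval_mul, eval_sub, eval_X, eval_C, sub_self, zero_mul, add_zero, eval_prod]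
    exact Finset.prod_ne_zero_iff.mpr fun j hj =>
      sub_ne_zero.mpr fun h => Finset.ne_of_mem_erase hj (hinj h).symm
  eval_zero hx := by
    obtain ⟨k, hk⟩ := exists_of_eval_rootPolynomial hx
    exact h0 k hk.symm
  good x hx := by
    obtain ⟨k, rfl⟩ := exists_of_eval_rootPolynomial hx
    exact hgood k

end rootFamily

/-- A root of `P` that is a root of `(x ^ 2 P)''` gives a critical point of the product of the
other factors. -/
theorem fderiv_lineProduct_eq_zero {P : ℝ[X]} {s c x : ℝ}
    (h : (derivative (derivative (X ^ 2 * ((X - C x) * P)))).eval x = 0) :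
    fderiv ℝ (lineProduct P s c) (x, s * x) = 0 := by
  refine ContinuousLinearMap.ext fun v => ?_
  -- At its root, the factor `X - x` turns the second derivative into twice the first derivative of
  -- `X² P`.
  have h1 : (derivative (X ^ 2 * P)).eval x = 0 := by
    simp [derivative_mul] at h ⊢
    linarith
  rw [fderiv_apply_of_eval (differentiable_lineProduct P s c _) (lineProduct_add_smul P s c _ v),
    restrictLine]
  simp [derivative_comp] at h1 ⊢
  linear_combination (-c ^ 2 * v.1) * h1

/-- Cancels a vertical factor off its line and extends by density; this identifies the product of
the other factors with a `lineProduct`. -/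
theorem continuous_unique_quotient {g h : ℝ × ℝ → ℝ} {x : ℝ} (hg : Continuous g)
    (hh : Continuous h) (he : ∀ p, (p.1 - x) * g p = (p.1 - x) * h p) : g = h := by
  have hd : Dense {p : ℝ × ℝ | p.1 ≠ x} :=
    (dense_compl_singleton x).preimage isOpenMap_fst
  exact hg.ext_on hd hh fun p hp => mul_left_cancel₀ (sub_ne_zero.mpr hp) (he p)

theorem prod_linearFactors {k : ℕ} (a : ℝ) (α : Fin k → ℝ) (p : ℝ × ℝ) :
    ∏ i, linearFactors a α i p = (p.2 - a * p.1) * ∏ i, (p.1 - α i) := by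
  simp [linearFactors, Fin.prod_univ_succ]

end HessianTopology

open HessianTopology
theorem theorem1 (m n : ℕ) (hmn : 0 < m + n) (a b : ℝ) (hab : a ≠ b)
    (α : Fin m → ℝ) (β : Fin n → ℝ)
    (hα : StrictAnti α) (hα0 : ∀ i, α i < 0) (hβ : StrictMono β) (hβ0 : ∀ j, 0 < β j)
    (hgood : GoodPosition (Sum.elim (linearFactors a α) (linearFactors b β)))
    (f : ℝ × ℝ → ℝ)
    (hf : f = fun p : ℝ × ℝ => (∏ i, linearFactors a α i p) * ∏ j, linearFactors b β j p) :
    ConsistsOfOuterOvals (hessianCurve f) (m + n) ∧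
      {p | IsSpecialParabolic f p}.encard = (3 * (m + n) : ℕ) ∧
      inflexionCurve f = {p | f p = 0} ∧
      overContactSet f = {p | f p = 0} := by
  have : Nonempty (Fin m ⊕ Fin n) := Fintype.card_pos_iff.mp (by simpa using hmn)
  set ρ : Fin m ⊕ Fin n → ℝ := Sum.elim α β with hρ
  -- Mean and half-difference of the slopes: `a = s + c`, `b = s - c`.
  set s := (a + b) / 2 with hs
  set c := (a - b) / 2 with hc
  have hc0 : c ≠ 0 := div_ne_zero (sub_ne_zero.mpr hab) two_ne_zero
  have hfP : f = lineProduct (rootPolynomial ρ) s c := by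
    funext p
    rw [hf, lineProduct, eval_rootPolynomial, Fintype.prod_sum_type]
    simp only [prod_linearFactors, hρ, Sum.elim_inl, Sum.elim_inr, hs, hc]
    ring
  have hinj : Function.Injective ρ := by
    rintro (i | i) (j | j) h <;> simp only [hρ, Sum.elim_inl, Sum.elim_inr] at h
    · rw [hα.injective h]
    · linarith [hα0 i, hβ0 j]
    · linarith [hα0 j, hβ0 i]
    · rw [hβ.injective h]
  have h0 : ∀ k, ρ k ≠ 0 := by
    rintro (i | i)
    · exact (hα0 i).ne
    · exact (hβ0 i).ne'
  have hadm : IsAdmissible (rootPolynomial ρ) := by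
    refine isAdmissible_rootPolynomial hinj h0 fun k h => ?_
    set l := Sum.elim (linearFactors a α) (linearFactors b β) with hl
    set i : Fin (m + 1) ⊕ Fin (n + 1) := Sum.map Fin.succ Fin.succ k with hi
    have hli : ∀ p, l i p = p.1 - ρ k := by
      rcases k with k | k <;> simp [hl, hi, hρ, linearFactors]
    have hlc : ∀ j, Continuous (l j) := by
      rintro (j | j) <;> refine Fin.cases ?_ (fun j => ?_) j <;>
        simp only [hl, linearFactors, Sum.elim_inl, Sum.elim_inr, Fin.cons_zero, Fin.cons_succ] <;>
        fun_prop
    rw [rootPolynomial_eq_mul ρ k] at h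
    refine hgood i (ρ k, s * ρ k) (by simp [hli]) ?_
    rw [← fderiv_lineProduct_eq_zero (s := s) (c := c) h]
    congr 1
    refine continuous_unique_quotient (x := ρ k)
      (continuous_finsetProd _ fun j _ => hlc j) (differentiable_lineProduct _ s c).continuous
      fun p => ?_
    have e1 : (p.1 - ρ k) * ∏ j ∈ Finset.univ.erase i, l j p = f p := by
      rw [← hli, Finset.mul_prod_erase _ (fun j => l j p) (Finset.mem_univ i),
        Fintype.prod_sum_type, hf]
      rfl
    rw [e1, hfP, lineProduct, rootPolynomial_eq_mul ρ k, lineProduct]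
    simp
    ring
  have hdeg : (rootPolynomial ρ).natDegree = m + n := by
    rw [natDegree_rootPolynomial]
    simp
  rw [hfP, ← hdeg]
  exact ⟨hadm.consistsOfOuterOvals hc0, hadm.encard_isSpecialParabolic hc0,
    hadm.inflexionCurve_eq hc0, hadm.overContactSet_eq hc0⟩
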